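/- **Setting.** Consider $\min_{x_1\in\mathbb R^{d_1},\dots,x_n\in\mathbb R^{d_n}} F(x)=\sum_{i=1}^n f_i(x_i)$ subject to $\sum_{i=1}^n(\mathbf A_ix_i-b_i)=0$, where $\mathbf A_i\in\mathbb R^{m\times d_i}$, $b_i\in\mathbb R^m$, and let $d=\sum_i d_i$, $\mathbf A=\operatorname{diag}(\mathbf A_1,\dots,\mathbf A_n)$, $\mathbf b=(b_1,\dots,b_n)\in(\mathbb R^m)^n$. Assume: 1. Each $f_i$ is continuously differentiable and $\frac{\mu_f}2\|v-u\|^2\le f_i(v)-f_i(u)-\langle\nabla f_i(u),v-u\rangle\le\frac{L_f}2\|v-u\|^2$ for all $u,v\in\mathbb R^{d_i}$, where $L_f\ge\mu_f>0$. 2. The constraint is feasible; $\sigma_{\max}^2(\mathbf A_i)\le L_{\mathbf A}$ for every $i$, and every positive eigenvalue of $\mathbf S=\frac1n\sum_i\mathbf A_i\mathbf A_i^\top$ is at least $\mu_{\mathbf A}$, where $L_{\mathbf A}\ge\mu_{\mathbf A}>0$. 3. $W\in\mathbb R^{n\times n}$ is a gossip matrix of an undirected communication graph on $\{1,\dots,n\}$: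 $W$ is symmetric positive semidefinite; $W_{ij}\ne0$ if and only if $i=j$ or $ij$ is an edge; $Wy=0$ if and only if $y_1=\dots=y_n$; every eigenvalue $\lambda$ of $W$ satisfies $\lambda^2\le L_{\mathbf W}$ and every nonzero one satisfies $\lambda^2\ge\mu_{\mathbf W}$, where $L_{\mathbf W}\ge\mu_{\mathbf W}>0$. Put $\mathbf W=W\otimes I_m$. Let $\kappa_f=L_f/\mu_f$, $\kappa_{\mathbf A}=L_{\mathbf A}/\mu_{\mathbf A}$, $\kappa_{\mathbf W}=\sqrt{L_{\mathbf W}/\mu_{\mathbf W}}$. **Algorithm.** Put $\mu_{\mathbf W'}=(11/15)^2$, $L_{\mathbf W'}=(19/15)^2$, $r=\frac{\mu_f}{2L_{\mathbf A}}$, $\gamma=\sqrt{(\mu_{\mathbf A}+L_{\mathbf A})/\mu_{\mathbf W'}}$, $L_{\mathbf B}=L_{\mathbf A}+(L_{\mathbf A}+\mu_{\mathbf A})L_{\mathbf W'}/\mu_{\mathbf W'}$, $\mu_{\mathbf B}=\mu_{\mathbf A}/2$, $\kappa_{\mathbf B}=L_{\mathbf B}/\mu_{\mathbf B}$, $$\tau=\min\Big\{1,\tfrac12\sqrt{\tfrac{19}{60\max\{1+\kappa_f,8\}}}\Big\},\quad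 \eta=\frac1{4\tau\max\{L_f+\mu_f,8\mu_f\}},\quad \theta=\frac{15}{19\eta},\quad \alpha=\frac{\mu_f}4 .$$ *Procedure $\mathrm{mul}\mathbf W'(y)$, $y\in(\mathbb R^m)^n$.* Let $\rho=(\sqrt{L_{\mathbf W}}-\sqrt{\mu_{\mathbf W}})^2/16$, $\nu=(\sqrt{L_{\mathbf W}}+\sqrt{\mu_{\mathbf W}})/2$, $\delta^0=-\nu/2$, $N=\lceil\sqrt{\kappa_{\mathbf W}}\rceil$, $p^0=-\mathbf Wy/\nu$, $y^1=y+p^0$. For $i=1,\dots,N-1$: $\beta^{i-1}=\rho/\delta^{i-1}$, $\delta^i=-(\nu+\beta^{i-1})$, $p^i=(\mathbf Wy^i+\beta^{i-1}p^{i-1})/\delta^i$, $y^{i+1}=y^i+p^i$. Return $y-y^N$. For $u=(x,y)\in\mathbb R^d\times(\mathbb R^m)^n$ and $q\in(\mathbb R^m)^n$ let $\mathrm{res}(u)=\mathbf Ax+\gamma\,\mathrm{mul}\mathbf W'(y)-\mathbf b$ and $\mathrm{adj}(q)=(\mathbf A^\top q,\ \gamma\,\mathrm{mul}\mathbf W'(q))$.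 *Procedure $\mathrm{grad\_G}(u)$, $u=(x,y)$.* Let $z=r\,\mathrm{res}(u)$. Return $(\nabla F(x),0)+\mathrm{adj}(z)$. *Procedure $\mathrm{K\_Chebyshev}(u)$.* Let $\rho=(L_{\mathbf B}-\mu_{\mathbf B})^2/16$, $\nu=(L_{\mathbf B}+\mu_{\mathbf B})/2$, $\delta^0=-\nu/2$, $N=\lceil\sqrt{\kappa_{\mathbf B}}\rceil$, $p^0=-\mathrm{adj}(\mathrm{res}(u))/\nu$, $u^1=u+p^0$. For $i=1,\dots,N-1$: $\beta^{i-1}=\rho/\delta^{i-1}$, $\delta^i=-(\nu+\beta^{i-1})$, $p^i=(\mathrm{adj}(\mathrm{res}(u^i))+\beta^{i-1}p^{i-1})/\delta^i$, $u^{i+1}=u^i+p^i$. Return $u-u^N$. *Main algorithm.* Given $x^0\in\mathbb R^d$, set $u^0=u_f^0=(x^0,0)$, $z^0=0$ and, for $k=0,1,2,\dots$, $$\begin{aligned} u_g^k&=\tau u^k+(1-\tau)u_f^k,\qquad g^k=\mathrm{grad\_G}(u_g^k)-\alpha u_g^k,\\ u^{k+1/2}&=(1+\eta\alpha)^{-1}\big(u^k-\eta(g^k+z^k)\big),\qquad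 z^{k+1}=z^k+\theta\,\mathrm{K\_Chebyshev}(u^{k+1/2}),\\ u^{k+1}&=(1+\eta\alpha)^{-1}\big(u^k-\eta(g^k+z^{k+1})\big),\qquad u_f^{k+1}=u_g^k+\tfrac{2\tau}{2-\tau}(u^{k+1}-u^k), \end{aligned}$$ and let $x^k\in\mathbb R^d$ be the first component of $u^k$. The cost of the first $k$ iterations is the number of evaluations of $\nabla F$, the total number of multiplications by $\mathbf A$ and by $\mathbf A^\top$, and the number of communication rounds (multiplications by $\mathbf W$) that they perform. **Theorem.** There is a universal constant $C>0$ such that, for every problem as above, there is a unique solution $x^*$, and for every starting point $x^0$: (a) there is $D>0$, depending on the problem and on $x^0$ but not on $\varepsilon$, such that for every $\varepsilon>0$ the algorithm finds an iterate $x^k$ with $\|x^k-x^*\|^2\le\varepsilon$ at a cost of at most $C\sqrt{\kappa_f}\,\ell$ gradient computations, at most $C\sqrt{\kappa_f}\sqrt{\kappa_{\mathbf A}}\,\ell$ multiplications by $\mathbf A$ and $\mathbf A^\top$, and at most $C\sqrt{\kappa_f}\sqrt{\kappa_{\mathbf A}}\sqrt{\kappa_{\mathbf W}}\,\ell$ communication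 rounds, where $\ell=\max\{0,\log(D/\varepsilon)\}$; (b) there is $\varepsilon_0\in(0,1)$, depending on the problem and on $x^0$, such that for all $0<\varepsilon\le\varepsilon_0$ the same holds with $\ell=\log(1/\varepsilon)$. That is, the algorithm uses $O(\sqrt{\kappa_f}\log(1/\varepsilon))$ gradient computations, $O(\sqrt{\kappa_f}\sqrt{\kappa_{\mathbf A}}\log(1/\varepsilon))$ multiplications by $\mathbf A$ and $\mathbf A^\top$, and $O(\sqrt{\kappa_f}\sqrt{\kappa_{\mathbf A}}\sqrt{\kappa_{\mathbf W}}\log(1/\varepsilon))$ communication rounds. -/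

import Mathlib

open scoped Matrix

noncomputable section

namespace CoupledOpt

/-! ## Vectors and block operators -/

/-- The primal space `ℝ^{d_1} × ⋯ × ℝ^{d_n}` with its Euclidean norm. -/
abbrev Primal (n : ℕ) (d : Fin n → ℕ) : Type :=
  PiLp 2 (fun i : Fin n => EuclideanSpace ℝ (Fin (d i)))

/-- The space `(ℝ^m)^n` with its Euclidean norm; block `i` is stored at node `i`. -/
abbrev Blocks (n m : ℕ) : Type :=
  PiLp 2 (fun _ : Fin n => EuclideanSpace ℝ (Fin m))

/-- Multiplication by the block-diagonal matrix `diag(A_1, …, A_n)`. -/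
def applyA {n m : ℕ} {d : Fin n → ℕ} (A : ∀ i, Matrix (Fin m) (Fin (d i)) ℝ)
    (x : Primal n d) : Blocks n m :=
  WithLp.toLp 2 (fun i => WithLp.toLp 2 (A i *ᵥ (x i).ofLp))

/-- Multiplication by the transpose of `diag(A_1, …, A_n)`. -/
def applyAT {n m : ℕ} {d : Fin n → ℕ} (A : ∀ i, Matrix (Fin m) (Fin (d i)) ℝ)
    (y : Blocks n m) : Primal n d :=
  WithLp.toLp 2 (fun i => WithLp.toLp 2 ((A i)ᵀ *ᵥ (y i).ofLp))

/-- Multiplication by `W ⊗ I_m`: node `i` forms `∑ j, W i j • y j`. -/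
def applyW {n m : ℕ} (W : Matrix (Fin n) (Fin n) ℝ) (y : Blocks n m) : Blocks n m :=
  WithLp.toLp 2 (fun i => ∑ j, W i j • y j)

/-- The gradient `(∇f_1(x_1), …, ∇f_n(x_n))` of `F(x) = ∑ f_i(x_i)`. -/
def gradF {n : ℕ} {d : Fin n → ℕ} (f : ∀ i, EuclideanSpace ℝ (Fin (d i)) → ℝ)
    (x : Primal n d) : Primal n d :=
  WithLp.toLp 2 (fun i => gradient (f i) (x i))

/-! ## The optimization problem and the assumptions -/

/-- The coupled constraint `∑ (A_i x_i - b_i) = 0`. -/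
def Feasible {n m : ℕ} {d : Fin n → ℕ} (A : ∀ i, Matrix (Fin m) (Fin (d i)) ℝ)
    (b : Blocks n m) (x : Primal n d) : Prop :=
  ∑ i, (A i *ᵥ (x i).ofLp - (b i).ofLp) = 0

/-- `x` solves `min ∑ f_i(x_i)` subject to `∑ (A_i x_i - b_i) = 0`. -/
def IsSolution {n m : ℕ} {d : Fin n → ℕ} (f : ∀ i, EuclideanSpace ℝ (Fin (d i)) → ℝ)
    (A : ∀ i, Matrix (Fin m) (Fin (d i)) ℝ) (b : Blocks n m) (x : Primal n d) : Prop :=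
  Feasible A b x ∧ ∀ x' : Primal n d, Feasible A b x' → ∑ i, f i (x i) ≤ ∑ i, f i (x' i)

/-- A continuously differentiable, `L`-smooth and `μ`-strongly convex function. -/
structure SmoothStronglyConvex {k : ℕ} (L μ : ℝ) (f : EuclideanSpace ℝ (Fin k) → ℝ) : Prop where
  contDiff : ContDiff ℝ 1 f
  lower : ∀ x₁ x₂, μ / 2 * ‖x₂ - x₁‖ ^ 2 ≤ f x₂ - f x₁ - inner ℝ (gradient f x₁) (x₂ - x₁)
  upper : ∀ x₁ x₂, f x₂ - f x₁ - inner ℝ (gradient f x₁) (x₂ - x₁) ≤ L / 2 * ‖x₂ - x₁‖ ^ 2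

/-- The matrix `S = (1/n) ∑ A_i A_iᵀ`. -/
def matS {n m : ℕ} {d : Fin n → ℕ} (A : ∀ i, Matrix (Fin m) (Fin (d i)) ℝ) :
    Matrix (Fin m) (Fin m) ℝ :=
  (1 / (n : ℝ)) • ∑ i, A i * (A i)ᵀ

/-- The constraint matrices: there is a feasible point, all squared singular values of every
`A_i` are at most `L`, all positive eigenvalues of `S` are at least `μ`. -/
structure ConstraintBounds {n m : ℕ} {d : Fin n → ℕ} (L μ : ℝ)
    (A : ∀ i, Matrix (Fin m) (Fin (d i)) ℝ) (b : Blocks n m) : Prop where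
  feasible : ∃ x : Primal n d, Feasible A b x
  upper : ∀ i, ∀ t ∈ spectrum ℝ ((A i)ᵀ * A i), t ≤ L
  lower : ∀ t ∈ spectrum ℝ (matS A), 0 < t → μ ≤ t

/-- `W` is a gossip matrix of the communication network `G`, with all eigenvalues satisfying
`t² ≤ L` and all nonzero eigenvalues satisfying `μ ≤ t²`. -/
structure IsGossip {n : ℕ} (G : SimpleGraph (Fin n)) (L μ : ℝ)
    (W : Matrix (Fin n) (Fin n) ℝ) : Prop where
  posSemidef : W.PosSemidef
  network : ∀ i j, W i j ≠ 0 ↔ (G.Adj i j ∨ i = j)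
  kernel : ∀ y : Fin n → ℝ, W *ᵥ y = 0 ↔ ∀ i j, y i = y j
  upper : ∀ t ∈ spectrum ℝ W, t ^ 2 ≤ L
  lower : ∀ t ∈ spectrum ℝ W, t ≠ 0 → μ ≤ t ^ 2

/-! ## Oracle programs and their cost -/

/-- A program that reaches `∇F`, `A`, `Aᵀ` and `W` only by queries; linear operations on vectors
that are already available are free. -/
inductive Prog (X Y : Type) (α : Type) : Type where
  | ret (a : α) : Prog X Y α
  | grad (x : X) (next : X → Prog X Y α) : Prog X Y α
  | mulA (x : X) (next : Y → Prog X Y α) : Prog X Y α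
  | mulAT (y : Y) (next : X → Prog X Y α) : Prog X Y α
  | mulW (y : Y) (next : Y → Prog X Y α) : Prog X Y α

namespace Prog

variable {X Y α β : Type}

/-- Sequential composition. -/
def seqThen : Prog X Y α → (α → Prog X Y β) → Prog X Y β
  | ret a, h => h a
  | grad x next, h => grad x (fun v => (next v).seqThen h)
  | mulA x next, h => mulA x (fun v => (next v).seqThen h)
  | mulAT y next, h => mulAT y (fun v => (next v).seqThen h)
  | mulW y next, h => mulW y (fun v => (next v).seqThen h)

instance : Monad (Prog X Y) where
  pure := ret
  bind := seqThen

/-- One computation of `∇F`. -/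
def askGrad (x : X) : Prog X Y X := grad x ret

/-- One multiplication by `A`. -/
def askA (x : X) : Prog X Y Y := mulA x ret

/-- One multiplication by `Aᵀ`. -/
def askAT (y : Y) : Prog X Y X := mulAT y ret

/-- One communication round, that is, one multiplication by `W`. -/
def askW (y : Y) : Prog X Y Y := mulW y ret

end Prog

/-- The answers to the queries. -/
structure Oracles (X Y : Type) where
  grad : X → X
  A : X → Y
  AT : Y → X
  W : Y → Y

/-- Numbers of queries: gradient computations, multiplications by `A` and by `Aᵀ` (counted
together), communication rounds. -/
structure Cost where
  grads : ℕ
  mulsA : ℕ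
  rounds : ℕ

namespace Prog

variable {X Y α : Type}

/-- The value a program returns. -/
def value (O : Oracles X Y) : Prog X Y α → α
  | ret a => a
  | grad x next => (next (O.grad x)).value O
  | mulA x next => (next (O.A x)).value O
  | mulAT y next => (next (O.AT y)).value O
  | mulW y next => (next (O.W y)).value O

/-- The numbers of queries a program makes. -/
def cost (O : Oracles X Y) : Prog X Y α → Cost
  | ret _ => ⟨0, 0, 0⟩
  | grad x next =>
      let c := (next (O.grad x)).cost O
      ⟨c.grads + 1, c.mulsA, c.rounds⟩
  | mulA x next =>
      let c := (next (O.A x)).cost O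
      ⟨c.grads, c.mulsA + 1, c.rounds⟩
  | mulAT y next =>
      let c := (next (O.AT y)).cost O
      ⟨c.grads, c.mulsA + 1, c.rounds⟩
  | mulW y next =>
      let c := (next (O.W y)).cost O
      ⟨c.grads, c.mulsA, c.rounds + 1⟩

end Prog

/-- The oracles of a concrete problem. -/
def oracles {n m : ℕ} {d : Fin n → ℕ} (f : ∀ i, EuclideanSpace ℝ (Fin (d i)) → ℝ)
    (A : ∀ i, Matrix (Fin m) (Fin (d i)) ℝ) (W : Matrix (Fin n) (Fin n) ℝ) :
    Oracles (Primal n d) (Blocks n m) where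
  grad := gradF f
  A := applyA A
  AT := applyAT A
  W := applyW W

/-! ## Parameters -/

/-- The constants of the problem that the algorithm is given. -/
structure Params where
  Lf : ℝ
  μf : ℝ
  LA : ℝ
  μA : ℝ
  LW : ℝ
  μW : ℝ

namespace Params

/-- The standing inequalities between the constants. -/
structure Valid (p : Params) : Prop where
  f_pos : 0 < p.μf
  f_le : p.μf ≤ p.Lf
  A_pos : 0 < p.μA
  A_le : p.μA ≤ p.LA
  W_pos : 0 < p.μW
  W_le : p.μW ≤ p.LW

variable (p : Params)

/-- Condition number of the objective. -/
def κf : ℝ := p.Lf / p.μf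

/-- Condition number of the constraint matrices. -/
def κA : ℝ := p.LA / p.μA

/-- Condition number of the gossip matrix (`LW`, `μW` bound squared eigenvalues). -/
def κW : ℝ := √(p.LW / p.μW)

/-- Upper bound on the squared eigenvalues of the preconditioned gossip matrix `W'`. -/
def LW' : ℝ := (19 / 15) ^ 2

/-- Lower bound on the squared nonzero eigenvalues of the preconditioned gossip matrix `W'`. -/
def μW' : ℝ := (11 / 15) ^ 2

/-- The augmentation parameter `r`. -/
def r : ℝ := p.μf / (2 * p.LA)

/-- The scaling `γ` of `W'`, with `γ² = (μ_A + L_A) / μ_{W'}`. -/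
def γ : ℝ := √((p.μA + p.LA) / μW')

/-- Upper bound on the squared singular values of `B = [A, γ W']`. -/
def LB : ℝ := p.LA + (p.LA + p.μA) * (LW' / μW')

/-- Lower bound on the squared nonzero singular values of `B = [A, γ W']`. -/
def μB : ℝ := p.μA / 2

/-- Condition number of `B`. -/
def κB : ℝ := p.LB / p.μB

/-- The momentum parameter `τ`. -/
def τ : ℝ := min 1 (1 / 2 * √(19 / (60 * max (1 + p.κf) 8)))

/-- The step size `η`. -/
def η : ℝ := 1 / (4 * p.τ * max (p.Lf + p.μf) (8 * p.μf))

/-- The dual step size `θ`. -/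
def θ : ℝ := 15 / (19 * p.η)

/-- The parameter `α`. -/
def α : ℝ := p.μf / 4

end Params

/-! ## The procedures

`X` stands for the primal space, `Y` for `(ℝ^m)^n`. -/

section Procedures

variable {X Y : Type} [AddCommGroup X] [Module ℝ X] [AddCommGroup Y] [Module ℝ Y]

/-- Iterations of the loop in `mulW'`: the arguments are the number of iterations left and the
current `y^i`, `p^{i-1}`, `δ^{i-1}`; the last `y` is returned. -/
def mulW'Loop (ρ ν : ℝ) : ℕ → Y → Y → ℝ → Prog X Y Y
  | 0, y, _, _ => return y
  | j + 1, y, q, δ => do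
      let β := ρ / δ
      let δ' := -(ν + β)
      let w ← Prog.askW y
      let q' := δ'⁻¹ • (w + β • q)
      mulW'Loop ρ ν j (y + q') q' δ'

/-- Multiplication by `W'`, the Chebyshev polynomial of `W`. -/
def mulW' (p : Params) (y : Y) : Prog X Y Y := do
  let ρ := (√p.LW - √p.μW) ^ 2 / 16
  let ν := (√p.LW + √p.μW) / 2
  let w ← Prog.askW y
  let p₀ := -(ν⁻¹ • w)
  let yn ← mulW'Loop ρ ν (⌈√p.κW⌉₊ - 1) (y + p₀) p₀ (-ν / 2)
  return y - yn

/-- The residual `A x + γ W' y - b`. -/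
def residual (p : Params) (b : Y) (u : X × Y) : Prog X Y Y := do
  let a ← Prog.askA u.1
  let w ← mulW' p u.2
  return a + p.γ • w - b

/-- The pair `(Aᵀ q, γ W' q)`. -/
def adjoint (p : Params) (q : Y) : Prog X Y (X × Y) := do
  let a ← Prog.askAT q
  let w ← mulW' p q
  return (a, p.γ • w)

/-- The gradient of `G(x, y) = F(x) + (r/2) ‖A x + γ W' y - b‖²`. -/
def gradG (p : Params) (b : Y) (u : X × Y) : Prog X Y (X × Y) := do
  let q ← residual p b u
  let z := p.r • q
  let g ← Prog.askGrad u.1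
  let v ← adjoint p z
  return (g + v.1, v.2)

/-- Iterations of the loop in `kChebyshev`: the arguments are the number of iterations left and
the current `u^i`, `p^{i-1}`, `δ^{i-1}`; the last `u` is returned. -/
def kChebyshevLoop (p : Params) (b : Y) (ρ ν : ℝ) :
    ℕ → X × Y → X × Y → ℝ → Prog X Y (X × Y)
  | 0, u, _, _ => return u
  | j + 1, u, s, δ => do
      let β := ρ / δ
      let δ' := -(ν + β)
      let q ← residual p b u
      let v ← adjoint p q
      let s' := δ'⁻¹ • v + (β / δ') • s
      kChebyshevLoop p b ρ ν j (u + s') s' δ'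

/-- The Chebyshev preconditioned constraint residual. -/
def kChebyshev (p : Params) (b : Y) (u : X × Y) : Prog X Y (X × Y) := do
  let ρ := (p.LB - p.μB) ^ 2 / 16
  let ν := (p.LB + p.μB) / 2
  let q ← residual p b u
  let v ← adjoint p q
  let p₀ := -(ν⁻¹ • v)
  let un ← kChebyshevLoop p b ρ ν (⌈√p.κB⌉₊ - 1) (u + p₀) p₀ (-ν / 2)
  return u - un

/-- The state `(u^k, u_f^k, z^k)` of the main algorithm. -/
structure State (X Y : Type) where
  u : X × Y
  uf : X × Y
  z : X × Y

/-- One iteration of the main algorithm. -/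
def step (p : Params) (b : Y) (s : State X Y) : Prog X Y (State X Y) := do
  let ug := p.τ • s.u + (1 - p.τ) • s.uf
  let dG ← gradG p b ug
  let g := dG - p.α • ug
  let uh := (1 + p.η * p.α)⁻¹ • (s.u - p.η • (g + s.z))
  let w ← kChebyshev p b uh
  let z' := s.z + p.θ • w
  let u' := (1 + p.η * p.α)⁻¹ • (s.u - p.η • (g + z'))
  let uf' := ug + (2 * p.τ / (2 - p.τ)) • (u' - s.u)
  return ⟨u', uf', z'⟩

/-- The first `k` iterations of the main algorithm, started at `x⁰`. -/
def mainAlg (p : Params) (b : Y) (x₀ : X) : ℕ → Prog X Y (State X Y)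
  | 0 => return ⟨(x₀, 0), (x₀, 0), 0⟩
  | k + 1 => do
      let s ← mainAlg p b x₀ k
      step p b s

end Procedures

/-- Started at `x₀`, the algorithm reaches an iterate `x^k` with `‖x^k - xs‖² ≤ ε`, where the `k`
iterations together use at most `C √κ_f ℓ` gradient computations, `C √κ_f √κ_A ℓ` multiplications
by `A` and `Aᵀ`, and `C √κ_f √κ_A √κ_W ℓ` communication rounds. -/
def ReachesWithin {n m : ℕ} {d : Fin n → ℕ} (p : Params)
    (f : ∀ i, EuclideanSpace ℝ (Fin (d i)) → ℝ) (A : ∀ i, Matrix (Fin m) (Fin (d i)) ℝ)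
    (b : Blocks n m) (W : Matrix (Fin n) (Fin n) ℝ) (x₀ xs : Primal n d) (C ε ℓ : ℝ) : Prop :=
  ∃ k : ℕ,
    ‖((mainAlg p b x₀ k).value (oracles f A W)).u.1 - xs‖ ^ 2 ≤ ε ∧
    (((mainAlg p b x₀ k).cost (oracles f A W)).grads : ℝ) ≤ C * √p.κf * ℓ ∧
    (((mainAlg p b x₀ k).cost (oracles f A W)).mulsA : ℝ) ≤ C * (√p.κf * √p.κA) * ℓ ∧
    (((mainAlg p b x₀ k).cost (oracles f A W)).rounds : ℝ) ≤ C * (√p.κf * √p.κA * √p.κW) * ℓ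

end CoupledOpt

end

/-!
# Linear convergence and oracle complexity of the decentralized accelerated method

Both inner procedures are Chebyshev iterations: `chebLoop_eq` identifies their iterates with scaled
Chebyshev polynomials `R_k / R_k(0)` of the operator, so that `mulW'` computes `W' = φ(W)` and
`kChebyshev` computes `K (u - u*)` with `K = φ(BᵀB)`, `B = [A, γ W']`, where
`φ = 1 - R_N / R_N(0)` (`chebPhi`). With `N ≥ √κ` steps `φ` takes values in `[11/15, 19/15]` on the
nonzero spectrum, because `cosh 2 > 15/4` (`cheb_gain`), and `φ(0) = 0`. Hence `W'` and `K` are well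
conditioned (`WellConditioned`) and keep the kernels of `W` and `B`.

The kernel of `W'` consists of the consensus vectors, so the coupled constraint for `x` is equivalent
to `A x + γ W' y = b` for some `y`, and a minimizer `x*` lifts to a solution `u* = (x*, y*)` with `y*`
in the range of `W'` (`exists_liftedProblem`). The nonzero spectrum of `BᵀB` lies in `[μ_B, L_B]`; the
lower bound is `mapBT_lower`, where a vector is split into its consensus part, controlled by `S`, and
the rest, controlled by `γ W'`. The augmented objective `F(x) + (r/2) ‖B u - b‖²` is smooth, and
strongly convex between `u*` and points whose `y` lies in the range of `W'`, a subspace that the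
iteration never leaves.

The main loop is then an accelerated primal-dual iteration with preconditioner `K`. Writing the dual
error as `K ζ`, one step contracts a Lyapunov function (`potential`) by the factor `1 + τ/12`
(`potential_step`). The dual part contracts because the dual error is, by the optimality condition of
the implicit primal step, bounded by three quantities whose squares the step dissipates. Since
`1/τ = O(√κ_f)`, and one iteration costs one gradient, `O(√κ_A)` multiplications by `A` and `Aᵀ` and
`O(√κ_A √κ_W)` rounds (`cost_mainAlg`), the complexity bounds follow. The constant `D` carries an
extra factor `e`, which absorbs the rounding up of the iteration count.
-/

namespace CoupledOpt

/-! ### Polynomials of a symmetric operator -/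

section Spectral

open Polynomial Module.End

variable {E : Type*} [NormedAddCommGroup E] [InnerProductSpace ℝ E]

/-- All nonzero eigenvalues of `M` lie in `[μ, L]`. -/
def EigenIn (μ L : ℝ) (M : E →ₗ[ℝ] E) : Prop :=
  ∀ t : ℝ, HasEigenvalue M t → t = 0 ∨ (μ ≤ t ∧ t ≤ L)

theorem isSymmetric_aeval {M : E →ₗ[ℝ] E} (hM : M.IsSymmetric) (q : ℝ[X]) :
    (aeval M q : E →ₗ[ℝ] E).IsSymmetric := by
  induction q using Polynomial.induction_on' with
  | add q₁ q₂ h₁ h₂ => rw [map_add]; exact h₁.add h₂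
  | monomial k a =>
    rw [aeval_monomial, ← Algebra.smul_def]
    exact (hM.pow k).smul (by simp)

theorem inner_aeval_nonneg [FiniteDimensional ℝ E] {M : E →ₗ[ℝ] E} (hM : M.IsSymmetric)
    {q : ℝ[X]} (hq : ∀ t, HasEigenvalue M t → 0 ≤ q.eval t) (v : E) :
    0 ≤ inner ℝ v ((aeval M q : E →ₗ[ℝ] E) v) := by
  have key : ∀ i, inner ℝ (hM.eigenvectorBasis rfl i) ((aeval M q : E →ₗ[ℝ] E) v)
      = q.eval (hM.eigenvalues rfl i) * inner ℝ (hM.eigenvectorBasis rfl i) v := by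
    intro i
    have h := aeval_apply_of_hasEigenvector (p := q) (hM.hasEigenvector_eigenvectorBasis rfl i)
    rw [← isSymmetric_aeval hM q, h, inner_smul_left]
    simp
  rw [← (hM.eigenvectorBasis rfl).sum_inner_mul_inner v]
  refine Finset.sum_nonneg fun i _ => ?_
  rw [key i, real_inner_comm]
  have : 0 ≤ q.eval (hM.eigenvalues rfl i) := hq _ (hM.hasEigenvalue_eigenvalues rfl i)
  nlinarith [mul_nonneg this (sq_nonneg (inner ℝ (hM.eigenvectorBasis rfl i) v))]

/-- A symmetric operator on a finite-dimensional space is onto the orthogonal complement of its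
kernel. -/
theorem exists_apply_eq_of_orthogonal_ker [FiniteDimensional ℝ E] {M : E →ₗ[ℝ] E}
    (hM : M.IsSymmetric) {v : E} (hv : ∀ w, M w = 0 → inner ℝ v w = 0) : ∃ w, M w = v := by
  have h : v ∈ (M.range)ᗮᗮ := by
    rw [hM.orthogonal_range, Submodule.mem_orthogonal]
    intro w hw
    rw [real_inner_comm]
    exact hv w hw
  rwa [Submodule.orthogonal_orthogonal] at h

/-- A lower bound on the nonzero eigenvalues bounds the quadratic form from below on the
orthogonal complement of the kernel. -/
theorem inner_ge_of_orthogonal_ker [FiniteDimensional ℝ E] {M : E →ₗ[ℝ] E} (hM : M.IsSymmetric)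
    {μ : ℝ} (hμ : ∀ t, HasEigenvalue M t → t = 0 ∨ μ ≤ t) (v : E)
    (hv : ∀ w, M w = 0 → inner ℝ v w = 0) : μ * ‖v‖ ^ 2 ≤ inner ℝ v (M v) := by
  obtain ⟨w, rfl⟩ := exists_apply_eq_of_orthogonal_ker hM hv
  have h := inner_aeval_nonneg hM (q := X ^ 3 - C μ * X ^ 2) (fun t ht => by
    rcases hμ t ht with rfl | h
    · simp
    · simp only [eval_sub, eval_pow, eval_X, eval_mul, eval_C]
      nlinarith [mul_nonneg (sq_nonneg t) (sub_nonneg.2 h)]) w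
  simp only [map_sub, map_mul, aeval_X, aeval_C, LinearMap.sub_apply,
    Module.algebraMap_end_eq_smul_id, pow_succ, pow_zero, one_mul, Module.End.mul_apply,
    LinearMap.smul_apply, LinearMap.id_apply, inner_sub_right, inner_smul_right] at h
  rw [← real_inner_self_eq_norm_sq, hM w (M w), hM w (M (M w))]
  linarith

/-- `K` is symmetric and its nonzero spectrum lies in `[l₁, l₂]`, expressed through quadratic
forms. -/
structure WellConditioned (l₁ l₂ : ℝ) (K : E →ₗ[ℝ] E) : Prop where
  symm : K.IsSymmetric
  lower : ∀ v, l₁ * inner ℝ v (K v) ≤ ‖K v‖ ^ 2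
  upper : ∀ v, ‖K v‖ ^ 2 ≤ l₂ * inner ℝ v (K v)
  norm_ge : ∀ v, l₁ ^ 2 * ‖K v‖ ^ 2 ≤ ‖K (K v)‖ ^ 2
  norm_le : ∀ v, ‖K v‖ ^ 2 ≤ l₂ ^ 2 * ‖v‖ ^ 2

theorem wellConditioned_aeval [FiniteDimensional ℝ E] {M : E →ₗ[ℝ] E} (hM : M.IsSymmetric)
    {μ L l₁ l₂ : ℝ} (hE : EigenIn μ L M) {q : ℝ[X]} (h₁ : 0 < l₁)
    (hq0 : q.eval 0 = 0) (hq : ∀ t, μ ≤ t → t ≤ L → l₁ ≤ q.eval t ∧ q.eval t ≤ l₂) :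
    WellConditioned l₁ l₂ (aeval M q : E →ₗ[ℝ] E) := by
  have hs := isSymmetric_aeval hM q
  have hv : ∀ t, HasEigenvalue M t → q.eval t = 0 ∨ (l₁ ≤ q.eval t ∧ q.eval t ≤ l₂) := by
    intro t ht
    rcases hE t ht with rfl | ⟨ha, hb⟩
    · exact Or.inl hq0
    · exact Or.inr (hq t ha hb)
  set K : E →ₗ[ℝ] E := aeval M q with hK
  have hsq : ∀ v, ‖K v‖ ^ 2 = inner ℝ v (K (K v)) := fun v => by
    rw [← real_inner_self_eq_norm_sq, hs]
  refine ⟨hs, fun v => ?_, fun v => ?_, fun v => ?_, fun v => ?_⟩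
  · have h := inner_aeval_nonneg hM (q := q ^ 2 - C l₁ * q) (fun t ht => by
      simp only [eval_sub, eval_pow, eval_mul, eval_C]
      rcases hv t ht with h | ⟨ha, hb⟩
      · simp [h]
      · nlinarith) v
    simp only [map_sub, map_mul, aeval_C, LinearMap.sub_apply, ← hK,
      Module.algebraMap_end_eq_smul_id, pow_succ, pow_zero, one_mul, Module.End.mul_apply,
      LinearMap.smul_apply, LinearMap.id_apply, inner_sub_right, inner_smul_right] at h
    rw [hsq]; linarith
  · have h := inner_aeval_nonneg hM (q := C l₂ * q - q ^ 2) (fun t ht => by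
      simp only [eval_sub, eval_pow, eval_mul, eval_C]
      rcases hv t ht with h | ⟨ha, hb⟩
      · simp [h]
      · nlinarith) v
    simp only [map_sub, map_mul, aeval_C, LinearMap.sub_apply, ← hK,
      Module.algebraMap_end_eq_smul_id, pow_succ, pow_zero, one_mul, Module.End.mul_apply,
      LinearMap.smul_apply, LinearMap.id_apply, inner_sub_right, inner_smul_right] at h
    rw [hsq]; linarith
  · have h := inner_aeval_nonneg hM (q := q ^ 4 - C (l₁ ^ 2) * q ^ 2) (fun t ht => by
      simp only [eval_sub, eval_pow, eval_mul, eval_C]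
      rcases hv t ht with h | ⟨ha, hb⟩
      · simp [h]
      · have : l₁ ^ 2 ≤ (q.eval t) ^ 2 := by gcongr
        nlinarith [mul_nonneg (sq_nonneg (q.eval t)) (sub_nonneg.2 this)]) v
    simp only [map_sub, map_mul, aeval_C, LinearMap.sub_apply, ← hK,
      Module.algebraMap_end_eq_smul_id, pow_succ, pow_zero, one_mul, Module.End.mul_apply,
      LinearMap.smul_apply, LinearMap.id_apply, inner_sub_right, inner_smul_right] at h
    rw [hsq, hsq, hs v]; linarith
  · have h := inner_aeval_nonneg hM (q := C (l₂ ^ 2) - q ^ 2) (fun t ht => by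
      simp only [eval_sub, eval_pow, eval_C]
      rcases hv t ht with h | ⟨ha, hb⟩
      · rw [h]; nlinarith [sq_nonneg l₂]
      · have : (q.eval t) ^ 2 ≤ l₂ ^ 2 := by gcongr; linarith
        linarith) v
    simp only [map_sub, map_mul, aeval_C, LinearMap.sub_apply, ← hK,
      Module.algebraMap_end_eq_smul_id, pow_succ, pow_zero, one_mul, Module.End.mul_apply,
      LinearMap.smul_apply, LinearMap.id_apply, inner_sub_right, inner_smul_right,
      real_inner_self_eq_norm_sq] at h
    rw [hsq]; nlinarith

/-- A polynomial that is bounded below by `l₁ > 0` on the nonzero spectrum does not enlarge the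
kernel. -/
theorem apply_eq_zero_of_aeval_eq_zero [FiniteDimensional ℝ E] {M : E →ₗ[ℝ] E}
    (hM : M.IsSymmetric) {μ L l₁ : ℝ} (hE : EigenIn μ L M) {q : ℝ[X]} (hμ : 0 < μ) (h₁ : 0 < l₁)
    (hq0 : q.eval 0 = 0) (hq : ∀ t, μ ≤ t → t ≤ L → l₁ ≤ q.eval t) {v : E}
    (hv : (aeval M q : E →ₗ[ℝ] E) v = 0) : M v = 0 := by
  have h := inner_aeval_nonneg hM (q := q * C (L ^ 2) - C l₁ * X ^ 2) (fun t ht => by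
    simp only [eval_sub, eval_pow, eval_mul, eval_C, eval_X]
    rcases hE t ht with rfl | ⟨ha, hb⟩
    · simp [hq0]
    · have h2 : t ^ 2 ≤ L ^ 2 := by gcongr; linarith
      nlinarith [hq t ha hb, mul_le_mul_of_nonneg_left h2 h₁.le, sq_nonneg L]) v
  rw [mul_comm] at h
  simp only [map_sub, map_mul, aeval_C, aeval_X, LinearMap.sub_apply,
    Module.algebraMap_end_eq_smul_id, pow_succ, pow_zero, one_mul, Module.End.mul_apply,
    LinearMap.smul_apply, LinearMap.id_apply, inner_sub_right, inner_smul_right, hv,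
    inner_zero_right, ← hM v, real_inner_self_eq_norm_sq] at h
  have h0 : ‖M v‖ ^ 2 ≤ 0 := by nlinarith
  simpa using le_antisymm h0 (sq_nonneg _)

end Spectral

/-! ### Chebyshev polynomials and the Chebyshev iteration -/

section Chebyshev

open Polynomial

/-- The scaled Chebyshev polynomials `h ^ k * T_k ((ν - t) / h)`. The scaling keeps them defined in
the degenerate case `h = 0`. -/
noncomputable def chebR (ν h : ℝ) : ℕ → ℝ[X]
  | 0 => 1
  | 1 => C ν - X
  | k + 2 => C 2 * (C ν - X) * chebR ν h (k + 1) - C (h ^ 2) * chebR ν h k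

theorem chebR_eval_succ_succ (ν h t : ℝ) (k : ℕ) :
    (chebR ν h (k + 2)).eval t
      = 2 * (ν - t) * (chebR ν h (k + 1)).eval t - h ^ 2 * (chebR ν h k).eval t := by
  simp [chebR]

/-- On the interval `[ν - h, ν + h]` the substitution `ν - t = h cos φ` shows `|R_k| ≤ h ^ k`. -/
theorem abs_chebR_eval_le {ν h t : ℝ} (hh : 0 ≤ h) (ht : |ν - t| ≤ h) (k : ℕ) :
    |(chebR ν h k).eval t| ≤ h ^ k := by
  obtain ⟨φ, hφ⟩ : ∃ φ, ν - t = h * Real.cos φ := by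
    rcases hh.eq_or_lt with rfl | hpos
    · exact ⟨0, by simpa using ht⟩
    · refine ⟨Real.arccos ((ν - t) / h), ?_⟩
      have h1 : |(ν - t) / h| ≤ 1 := by
        rw [abs_div, abs_of_pos hpos]; exact (div_le_one hpos).2 ht
      rw [Real.cos_arccos (abs_le.1 h1).1 (abs_le.1 h1).2]
      field_simp
  have key : ∀ k : ℕ, (chebR ν h k).eval t = h ^ k * Real.cos (k * φ) := by
    intro k
    induction k using Nat.twoStepInduction with
    | zero => simp [chebR]
    | one => simp [chebR, hφ]
    | more k ih0 ih1 =>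
      rw [chebR_eval_succ_succ, ih0, ih1, hφ]
      have e : Real.cos ((k + 2 : ℕ) * φ)
          = 2 * Real.cos φ * Real.cos ((k + 1 : ℕ) * φ) - Real.cos (k * φ) := by
        have e1 : ((k + 2 : ℕ) : ℝ) * φ = ((k + 1 : ℕ) : ℝ) * φ + φ := by push_cast; ring
        have e2 : (k : ℝ) * φ = ((k + 1 : ℕ) : ℝ) * φ - φ := by push_cast; ring
        rw [e1, e2, Real.cos_add, Real.cos_sub]; ring
      rw [e]; ring
  rw [key, abs_mul, abs_of_nonneg (pow_nonneg hh k)]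
  exact mul_le_of_le_one_right (pow_nonneg hh k) (Real.abs_cos_le_one _)

theorem chebR_eval_zero (a b : ℝ) (k : ℕ) :
    (chebR ((a ^ 2 + b ^ 2) / 2) ((a ^ 2 - b ^ 2) / 2) k).eval 0
      = (((a + b) ^ 2 / 2) ^ k + ((a - b) ^ 2 / 2) ^ k) / 2 := by
  induction k using Nat.twoStepInduction with
  | zero => simp [chebR]
  | one => simp [chebR]; ring
  | more k ih0 ih1 => rw [chebR_eval_succ_succ, ih0, ih1]; ring

theorem exp_two_mul_mul_one_sub_le {x : ℝ} (h0 : 0 ≤ x) (h1 : x < 1) :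
    Real.exp (2 * x) * (1 - x) ≤ 1 + x := by
  have hs := Real.hasSum_log_sub_log_of_abs_lt_one (x := x) (by rwa [abs_of_nonneg h0])
  have h := hs.summable.sum_le_tsum {0} (fun i _ => by positivity)
  rw [hs.tsum_eq] at h
  simp only [Finset.sum_singleton, Nat.cast_zero, mul_zero, zero_add, pow_one, div_one,
    mul_one] at h
  have hx : 0 < 1 - x := by linarith
  rw [← Real.log_div (by linarith) hx.ne', Real.le_log_iff_exp_le (by positivity),
    le_div_iff₀ hx] at h
  exact h

/-- After `N ≥ a / b` steps the ratio `T_N((κ + 1) / (κ - 1))` exceeds `cosh 2 > 15 / 4`, where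
`κ = (a / b) ^ 2`; stated without the division, so that `κ = 1` is included. -/
theorem cheb_gain {a b : ℝ} (hb : 0 < b) (hab : b ≤ a) {N : ℕ} (hN : a / b ≤ N) :
    ((a ^ 2 - b ^ 2) / 2) ^ N
      ≤ 4 / 15 * ((((a + b) ^ 2 / 2) ^ N + ((a - b) ^ 2 / 2) ^ N) / 2) := by
  have ha : 0 < a := hb.trans_le hab
  have hN0 : N ≠ 0 := by
    rintro rfl
    have : 0 < a / b := by positivity
    simp at hN; linarith
  rcases hab.eq_or_lt with rfl | hlt
  · simp [hN0]; positivity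
  have hx1 : b / a < 1 := (div_lt_one ha).2 hlt
  have hstep : Real.exp (2 * (b / a)) * (a - b) ≤ a + b := by
    have := mul_le_mul_of_nonneg_left
      (exp_two_mul_mul_one_sub_le (x := b / a) (by positivity) hx1) ha.le
    have e1 : a * (Real.exp (2 * (b / a)) * (1 - b / a)) = Real.exp (2 * (b / a)) * (a - b) := by
      field_simp
    have e2 : a * (1 + b / a) = a + b := by field_simp
    rwa [e1, e2] at this
  have hY : 0 < (a - b) ^ N := pow_pos (by linarith) N
  have hpow : 7.38 * (a - b) ^ N ≤ (a + b) ^ N := by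
    have h1 : Real.exp (2 * (b / a)) ^ N * (a - b) ^ N ≤ (a + b) ^ N := by
      rw [← mul_pow]
      exact pow_le_pow_left₀ (mul_nonneg (Real.exp_pos _).le (by linarith)) hstep N
    have h2 : (7.38 : ℝ) ≤ Real.exp (2 * (b / a)) ^ N := by
      rw [← Real.exp_nat_mul]
      have h3 : (1 : ℝ) + 1 ≤ N * (2 * (b / a)) := by
        rw [div_le_iff₀ hb] at hN
        have : 1 ≤ N * (b / a) := by
          rw [mul_div_assoc', le_div_iff₀ ha]; linarith
        linarith
      refine le_trans ?_ (Real.exp_le_exp.2 h3)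
      rw [Real.exp_add]
      nlinarith [Real.exp_one_gt_d9]
    nlinarith
  have e0 : ((a ^ 2 - b ^ 2) / 2) ^ N = (1 / 2) ^ N * ((a + b) ^ N * (a - b) ^ N) := by
    rw [← mul_pow, ← mul_pow]; congr 1; ring
  have e1 : ((a + b) ^ 2 / 2) ^ N = (1 / 2) ^ N * ((a + b) ^ N) ^ 2 := by
    rw [← pow_mul, mul_comm N 2, pow_mul, ← mul_pow]; congr 1; ring
  have e2 : ((a - b) ^ 2 / 2) ^ N = (1 / 2) ^ N * ((a - b) ^ N) ^ 2 := by
    rw [← pow_mul, mul_comm N 2, pow_mul, ← mul_pow]; congr 1; ring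
  rw [e0, e1, e2]
  have h5 : (0 : ℝ) < (1 / 2) ^ N := by positivity
  have h6 : (a + b) ^ N * (a - b) ^ N
      ≤ 4 / 15 * ((((a + b) ^ N) ^ 2 + ((a - b) ^ N) ^ 2) / 2) := by
    nlinarith [mul_nonneg (sub_nonneg.2 hpow) (by linarith : 0 ≤ 7.38 * (a + b) ^ N - (a - b) ^ N),
      mul_pos hY (hY.trans_le (by linarith : (a - b) ^ N ≤ (a + b) ^ N))]
  nlinarith [mul_le_mul_of_nonneg_left h6 h5.le]

/-- The Chebyshev preconditioner `1 - R_N / R_N(0)` for the spectral interval `[μ, L]`. -/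
noncomputable def chebPhi (L μ : ℝ) (N : ℕ) : ℝ[X] :=
  1 - C ((chebR ((L + μ) / 2) ((L - μ) / 2) N).eval 0)⁻¹ * chebR ((L + μ) / 2) ((L - μ) / 2) N

theorem chebR_eval_zero_pos {L μ : ℝ} (hμ : 0 < μ) (hL : μ ≤ L) (k : ℕ) :
    0 < (chebR ((L + μ) / 2) ((L - μ) / 2) k).eval 0 := by
  have h := chebR_eval_zero (√L) (√μ) k
  rw [Real.sq_sqrt (hμ.le.trans hL), Real.sq_sqrt hμ.le] at h
  rw [h]
  have : 0 < √μ := Real.sqrt_pos.2 hμ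
  positivity

theorem chebPhi_eval_zero {L μ : ℝ} (hμ : 0 < μ) (hL : μ ≤ L) (N : ℕ) :
    (chebPhi L μ N).eval 0 = 0 := by
  have := chebR_eval_zero_pos hμ hL N
  simp [chebPhi, this.ne']

theorem chebPhi_eval_mem {L μ : ℝ} (hμ : 0 < μ) (hL : μ ≤ L) {N : ℕ} (hN : √(L / μ) ≤ N)
    {t : ℝ} (h₁ : μ ≤ t) (h₂ : t ≤ L) :
    11 / 15 ≤ (chebPhi L μ N).eval t ∧ (chebPhi L μ N).eval t ≤ 19 / 15 := by
  have hc := chebR_eval_zero_pos hμ hL N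
  have hb : 0 < √μ := Real.sqrt_pos.2 hμ
  have hg := cheb_gain hb (Real.sqrt_le_sqrt hL) (N := N) (by rwa [← Real.sqrt_div' _ hμ.le])
  rw [← chebR_eval_zero, Real.sq_sqrt (hμ.le.trans hL), Real.sq_sqrt hμ.le] at hg
  have hR := abs_chebR_eval_le (ν := (L + μ) / 2) (h := (L - μ) / 2) (t := t) (by linarith)
    (by rw [abs_le]; constructor <;> linarith) N
  set c := (chebR ((L + μ) / 2) ((L - μ) / 2) N).eval 0
  have hq : |c⁻¹ * (chebR ((L + μ) / 2) ((L - μ) / 2) N).eval t| ≤ 4 / 15 := by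
    rw [abs_mul, abs_of_pos (inv_pos.2 hc), inv_mul_le_iff₀ hc, mul_comm]
    exact hR.trans hg
  rw [abs_le] at hq
  simp only [chebPhi, eval_sub, eval_one, eval_mul, eval_C]
  constructor <;> linarith [hq.1, hq.2]

/-- The last iterate of the Chebyshev iteration with operator `op`, after `j` further steps from the
iterate `u`, the previous increment `q` and the previous coefficient `δ`. -/
noncomputable def chebLoop {V : Type*} [AddCommGroup V] [Module ℝ V] (op : V → V) (ρ ν : ℝ) :
    ℕ → V → V → ℝ → V
  | 0, u, _, _ => u
  | j + 1, u, q, δ =>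
      let δ' := -(ν + ρ / δ)
      let q' := δ'⁻¹ • op u + (ρ / δ / δ') • q
      chebLoop op ρ ν j (u + q') q' δ'

variable {V E : Type*} [AddCommGroup V] [Module ℝ V] [AddCommGroup E] [Module ℝ E]

/-- The iterates of the Chebyshev iteration are the polynomials `R_k / R_k(0)` of the operator
applied to the initial error. The iteration may live on a space `V` that is identified with `E`
through `ι`, and its operator may be affine with zero `s`. -/
theorem chebLoop_eq {L μ : ℝ} (hμ : 0 < μ) (hL : μ ≤ L) (op : V → V) (ι : V →ₗ[ℝ] E)
    (M : E →ₗ[ℝ] E) (s e : E) (hop : ∀ u, ι (op u) = M (ι u - s)) (j : ℕ) :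
    ∀ (k : ℕ) (u q : V) (δ : ℝ),
      let R := chebR ((L + μ) / 2) ((L - μ) / 2)
      ι u - s = ((R (k + 1)).eval 0)⁻¹ • (aeval M (R (k + 1)) : E →ₗ[ℝ] E) e →
      ι q = ((R (k + 1)).eval 0)⁻¹ • (aeval M (R (k + 1)) : E →ₗ[ℝ] E) e
        - ((R k).eval 0)⁻¹ • (aeval M (R k) : E →ₗ[ℝ] E) e →
      δ = -((R (k + 1)).eval 0 / (2 * (R k).eval 0)) →
      ι (chebLoop op ((L - μ) ^ 2 / 16) ((L + μ) / 2) j u q δ) - s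
        = ((R (k + 1 + j)).eval 0)⁻¹ • (aeval M (R (k + 1 + j)) : E →ₗ[ℝ] E) e := by
  induction j with
  | zero => intro k u q δ R hu _ _; simpa [chebLoop] using hu
  | succ j ih =>
    intro k u q δ R hu hq hδ
    have hc : ∀ i, 0 < (R i).eval 0 := fun i => chebR_eval_zero_pos hμ hL i
    have hc0 := (hc k).ne'
    have hc1 := (hc (k + 1)).ne'
    have hc2 := (hc (k + 2)).ne'
    have hrec : (R (k + 2)).eval 0 = (L + μ) * (R (k + 1)).eval 0
        - ((L - μ) / 2) ^ 2 * (R k).eval 0 := by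
      rw [chebR_eval_succ_succ]; ring
    have hvec : (aeval M (R (k + 2)) : E →ₗ[ℝ] E) e
        = (L + μ) • (aeval M (R (k + 1)) : E →ₗ[ℝ] E) e
          - (2 : ℝ) • M ((aeval M (R (k + 1)) : E →ₗ[ℝ] E) e)
          - ((L - μ) / 2) ^ 2 • (aeval M (R k) : E →ₗ[ℝ] E) e := by
      simp only [R, chebR, map_sub, map_mul, aeval_C, aeval_X, LinearMap.sub_apply,
        Module.algebraMap_end_eq_smul_id, Module.End.mul_apply, LinearMap.smul_apply,
        LinearMap.id_apply]
      module
    have hβ : (L - μ) ^ 2 / 16 / δ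
        = -((L - μ) ^ 2 / 8 * (R k).eval 0 / (R (k + 1)).eval 0) := by
      rw [hδ]; field_simp; ring
    have hδ' : -((L + μ) / 2 + (L - μ) ^ 2 / 16 / δ)
        = -((R (k + 2)).eval 0 / (2 * (R (k + 1)).eval 0)) := by
      rw [hβ, hrec]; field_simp; ring
    have hq' : ι ((-((L + μ) / 2 + (L - μ) ^ 2 / 16 / δ))⁻¹ • op u
          + ((L - μ) ^ 2 / 16 / δ / -((L + μ) / 2 + (L - μ) ^ 2 / 16 / δ)) • q)
        = ((R (k + 2)).eval 0)⁻¹ • (aeval M (R (k + 2)) : E →ₗ[ℝ] E) e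
          - ((R (k + 1)).eval 0)⁻¹ • (aeval M (R (k + 1)) : E →ₗ[ℝ] E) e := by
      rw [hδ', hβ, map_add, map_smul, map_smul, hop, hu, hq, hvec, map_smul]
      match_scalars
      · field_simp
      · field_simp
        linear_combination 8 * hrec
      · field_simp; norm_num
    have h := ih (k + 1) (u + ((-((L + μ) / 2 + (L - μ) ^ 2 / 16 / δ))⁻¹ • op u
          + ((L - μ) ^ 2 / 16 / δ / -((L + μ) / 2 + (L - μ) ^ 2 / 16 / δ)) • q)) _ _
      (by rw [map_add, hq', add_sub_right_comm, hu]; abel) hq' hδ'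
    rw [show k + 1 + (j + 1) = k + 1 + 1 + j by ring]
    exact h

/-- The full Chebyshev procedure returns the preconditioner `chebPhi` of the operator applied to
the initial error. -/
theorem sub_chebLoop_eq {L μ : ℝ} (hμ : 0 < μ) (hL : μ ≤ L) (op : V → V) (ι : V →ₗ[ℝ] E)
    (M : E →ₗ[ℝ] E) (s : E) (hop : ∀ u, ι (op u) = M (ι u - s)) {N : ℕ} (hN : 1 ≤ N) (u : V) :
    ι (u - chebLoop op ((L - μ) ^ 2 / 16) ((L + μ) / 2) (N - 1)
        (u + -(((L + μ) / 2)⁻¹ • op u)) (-(((L + μ) / 2)⁻¹ • op u)) (-((L + μ) / 2) / 2))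
      = (aeval M (chebPhi L μ N) : E →ₗ[ℝ] E) (ι u - s) := by
  have hν : (L + μ) / 2 ≠ 0 := by linarith
  obtain ⟨e, he⟩ : ∃ e, ι u - s = e := ⟨_, rfl⟩
  have h := chebLoop_eq hμ hL op ι M s e hop (N - 1) 0
    (u + -(((L + μ) / 2)⁻¹ • op u)) (-(((L + μ) / 2)⁻¹ • op u)) (-((L + μ) / 2) / 2)
  simp only [chebR, zero_add, eval_sub, eval_C, eval_X, sub_zero, eval_one, inv_one, one_smul,
    map_sub, map_one, aeval_C, aeval_X, LinearMap.sub_apply, Module.algebraMap_end_eq_smul_id,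
    LinearMap.smul_apply, LinearMap.id_apply, map_add, map_neg, map_smul, hop, mul_one,
    Module.End.one_apply, he, Nat.add_sub_cancel' hN, smul_sub, smul_smul, inv_mul_cancel₀ hν,
    add_sub_right_comm] at h
  have h' := h (by abel) (by abel) (by ring)
  rw [he]
  simp only [chebPhi, map_sub, map_one, map_mul, aeval_C, LinearMap.sub_apply,
    Module.algebraMap_end_eq_smul_id, Module.End.mul_apply, LinearMap.smul_apply,
    LinearMap.id_apply, Module.End.one_apply]
  rw [← h', ← he]
  abel

end Chebyshev

/-! ### Values and costs of the procedures -/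

namespace Prog

variable {X Y α β : Type} (O : Oracles X Y)

@[simp] theorem value_pure (a : α) : (pure a : Prog X Y α).value O = a := rfl
@[simp] theorem value_askGrad (x : X) : (askGrad x : Prog X Y X).value O = O.grad x := rfl
@[simp] theorem value_askA (x : X) : (askA x : Prog X Y Y).value O = O.A x := rfl
@[simp] theorem value_askAT (y : Y) : (askAT y : Prog X Y X).value O = O.AT y := rfl
@[simp] theorem value_askW (y : Y) : (askW y : Prog X Y Y).value O = O.W y := rfl

@[simp] theorem cost_pure (a : α) : (pure a : Prog X Y α).cost O = ⟨0, 0, 0⟩ := rfl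
@[simp] theorem cost_askGrad (x : X) : (askGrad x : Prog X Y X).cost O = ⟨1, 0, 0⟩ := rfl
@[simp] theorem cost_askA (x : X) : (askA x : Prog X Y Y).cost O = ⟨0, 1, 0⟩ := rfl
@[simp] theorem cost_askAT (y : Y) : (askAT y : Prog X Y X).cost O = ⟨0, 1, 0⟩ := rfl
@[simp] theorem cost_askW (y : Y) : (askW y : Prog X Y Y).cost O = ⟨0, 0, 1⟩ := rfl

@[simp] theorem value_bind (x : Prog X Y α) (h : α → Prog X Y β) :
    (x >>= h).value O = (h (x.value O)).value O := by
  change (x.seqThen h).value O = _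
  induction x with
  | ret a => rfl
  | grad x next ih => exact ih _
  | mulA x next ih => exact ih _
  | mulAT y next ih => exact ih _
  | mulW y next ih => exact ih _

@[simp] theorem cost_bind (x : Prog X Y α) (h : α → Prog X Y β) :
    (x >>= h).cost O = ⟨(x.cost O).grads + ((h (x.value O)).cost O).grads,
      (x.cost O).mulsA + ((h (x.value O)).cost O).mulsA,
      (x.cost O).rounds + ((h (x.value O)).cost O).rounds⟩ := by
  change (x.seqThen h).cost O = _
  induction x with
  | ret a => simp [seqThen, cost, value]
  | grad x next ih => simp only [seqThen, cost, value, ih]; congr 1; ring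
  | mulA x next ih => simp only [seqThen, cost, value, ih]; congr 1; ring
  | mulAT y next ih => simp only [seqThen, cost, value, ih]; congr 1; ring
  | mulW y next ih => simp only [seqThen, cost, value, ih]; congr 1; ring

end Prog

section Procedures

variable {X Y : Type} [AddCommGroup Y] [Module ℝ Y]
  (O : Oracles X Y) (p : Params) (b : Y)

theorem value_mulW'Loop (ρ ν : ℝ) (j : ℕ) (y q : Y) (δ : ℝ) :
    (mulW'Loop ρ ν j y q δ : Prog X Y Y).value O = chebLoop O.W ρ ν j y q δ := by
  induction j generalizing y q δ with
  | zero => simp [mulW'Loop, chebLoop]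
  | succ j ih =>
    simp only [mulW'Loop, chebLoop, Prog.value_bind, Prog.value_askW, ih]
    simp only [smul_add, smul_smul, inv_mul_eq_div]

theorem cost_mulW'Loop (ρ ν : ℝ) (j : ℕ) (y q : Y) (δ : ℝ) :
    (mulW'Loop ρ ν j y q δ : Prog X Y Y).cost O = ⟨0, 0, j⟩ := by
  induction j generalizing y q δ with
  | zero => simp [mulW'Loop]
  | succ j ih => simp [mulW'Loop, ih, add_comm]

/-- The number of communication rounds of one call of `mulW'`. -/
noncomputable def Params.stepsW : ℕ := ⌈√p.κW⌉₊

/-- The number of Chebyshev iterations in one call of `kChebyshev`. -/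
noncomputable def Params.stepsB : ℕ := ⌈√p.κB⌉₊

theorem value_mulW'_eq (y : Y) : (mulW' p y : Prog X Y Y).value O
    = y - chebLoop O.W ((√p.LW - √p.μW) ^ 2 / 16) ((√p.LW + √p.μW) / 2) (p.stepsW - 1)
        (y + -(((√p.LW + √p.μW) / 2)⁻¹ • O.W y)) (-(((√p.LW + √p.μW) / 2)⁻¹ • O.W y))
        (-((√p.LW + √p.μW) / 2) / 2) := by
  simp [mulW', value_mulW'Loop, Params.stepsW]

theorem cost_mulW' (hW : 1 ≤ p.stepsW) (y : Y) :
    (mulW' p y : Prog X Y Y).cost O = ⟨0, 0, p.stepsW⟩ := by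
  simp only [Params.stepsW] at hW ⊢
  simp [mulW', cost_mulW'Loop]
  omega

variable {O p} {Wp : Y → Y}

theorem value_residual (hWp : ∀ y, (mulW' p y : Prog X Y Y).value O = Wp y) (u : X × Y) :
    (residual p b u).value O = O.A u.1 + p.γ • Wp u.2 - b := by
  simp [residual, hWp]

theorem value_adjoint (hWp : ∀ y, (mulW' p y : Prog X Y Y).value O = Wp y) (q : Y) :
    (adjoint p q : Prog X Y (X × Y)).value O = (O.AT q, p.γ • Wp q) := by
  simp [adjoint, hWp]

theorem cost_residual (hW : 1 ≤ p.stepsW) (u : X × Y) :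
    (residual p b u).cost O = ⟨0, 1, p.stepsW⟩ := by
  simp [residual, cost_mulW' O p hW]

theorem cost_adjoint (hW : 1 ≤ p.stepsW) (q : Y) :
    (adjoint p q : Prog X Y (X × Y)).cost O = ⟨0, 1, p.stepsW⟩ := by
  simp [adjoint, cost_mulW' O p hW]

variable [AddCommGroup X]

theorem value_gradG (hWp : ∀ y, (mulW' p y : Prog X Y Y).value O = Wp y) (u : X × Y) :
    (gradG p b u).value O = (O.grad u.1 + O.AT (p.r • (O.A u.1 + p.γ • Wp u.2 - b)),
      p.γ • Wp (p.r • (O.A u.1 + p.γ • Wp u.2 - b))) := by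
  simp [gradG, value_residual b hWp, value_adjoint hWp]

theorem cost_gradG (hW : 1 ≤ p.stepsW) (u : X × Y) :
    (gradG p b u).cost O = ⟨1, 2, 2 * p.stepsW⟩ := by
  simp [gradG, cost_residual b hW, cost_adjoint hW, two_mul]

variable [Module ℝ X]

theorem cost_kChebyshevLoop (hW : 1 ≤ p.stepsW) (ρ ν : ℝ) (j : ℕ) (u s : X × Y) (δ : ℝ) :
    (kChebyshevLoop p b ρ ν j u s δ).cost O = ⟨0, 2 * j, 2 * p.stepsW * j⟩ := by
  induction j generalizing u s δ with
  | zero => simp [kChebyshevLoop]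
  | succ j ih =>
    simp [kChebyshevLoop, ih, cost_residual b hW, cost_adjoint hW]
    constructor <;> ring

theorem cost_kChebyshev (hW : 1 ≤ p.stepsW) (hB : 1 ≤ p.stepsB) (u : X × Y) :
    (kChebyshev p b u).cost O = ⟨0, 2 * p.stepsB, 2 * p.stepsW * p.stepsB⟩ := by
  obtain ⟨j, hj⟩ := Nat.exists_eq_add_of_le hB
  rw [hj]
  simp only [Params.stepsB] at hj
  simp [kChebyshev, cost_kChebyshevLoop b hW, cost_residual b hW, cost_adjoint hW, hj]
  constructor <;> ring

theorem cost_step (hW : 1 ≤ p.stepsW) (hB : 1 ≤ p.stepsB) (s : State X Y) :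
    (step p b s).cost O
      = ⟨1, 2 + 2 * p.stepsB, 2 * p.stepsW + 2 * p.stepsW * p.stepsB⟩ := by
  simp [step, cost_gradG b hW, cost_kChebyshev b hW hB]

theorem cost_mainAlg (hW : 1 ≤ p.stepsW) (hB : 1 ≤ p.stepsB) (x₀ : X) (k : ℕ) :
    (mainAlg p b x₀ k).cost O
      = ⟨k, k * (2 + 2 * p.stepsB), k * (2 * p.stepsW + 2 * p.stepsW * p.stepsB)⟩ := by
  induction k with
  | zero => simp [mainAlg]
  | succ k ih =>
    simp [mainAlg, ih, cost_step b hW hB]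
    constructor <;> ring

/-- The normal-equation operator `u ↦ Bᵀ (B u - b)` of `B = [A, γ W']`. -/
noncomputable def normalOp (O : Oracles X Y) (p : Params) (b : Y) (Wp : Y → Y) (u : X × Y) :
    X × Y :=
  (O.AT (O.A u.1 + p.γ • Wp u.2 - b), p.γ • Wp (O.A u.1 + p.γ • Wp u.2 - b))

theorem value_kChebyshevLoop (hWp : ∀ y, (mulW' p y : Prog X Y Y).value O = Wp y) (ρ ν : ℝ)
    (j : ℕ) (u s : X × Y) (δ : ℝ) :
    (kChebyshevLoop p b ρ ν j u s δ).value O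
      = chebLoop (normalOp O p b Wp) ρ ν j u s δ := by
  induction j generalizing u s δ with
  | zero => simp [kChebyshevLoop, chebLoop]
  | succ j ih =>
    simp only [kChebyshevLoop, chebLoop, Prog.value_bind, value_residual b hWp,
      value_adjoint hWp, ih, normalOp]

theorem value_kChebyshev (hWp : ∀ y, (mulW' p y : Prog X Y Y).value O = Wp y) (u : X × Y) :
    (kChebyshev p b u).value O
      = u - chebLoop (normalOp O p b Wp) ((p.LB - p.μB) ^ 2 / 16) ((p.LB + p.μB) / 2)
          (p.stepsB - 1) (u + -(((p.LB + p.μB) / 2)⁻¹ • normalOp O p b Wp u))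
          (-(((p.LB + p.μB) / 2)⁻¹ • normalOp O p b Wp u)) (-((p.LB + p.μB) / 2) / 2) := by
  simp only [kChebyshev, Prog.value_bind, value_residual b hWp, value_adjoint hWp,
    value_kChebyshevLoop b hWp, Prog.value_pure, Params.stepsB]
  rfl

end Procedures

/-! ### The Lyapunov function of the accelerated primal-dual iteration -/

section Lyapunov

variable {E : Type*} [NormedAddCommGroup E] [InnerProductSpace ℝ E]

/-- The dual part of the Lyapunov function, in terms of a preimage `ζ` under `K` of the error of the
dual variable. The inner product `⟪ζ, K ζ⟫` is the squared norm of that error in the metric of the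
pseudoinverse of `K`, which thereby need not be formed. -/
noncomputable def dualPotential (η α : ℝ) (K : E →ₗ[ℝ] E) (ζ : E) : ℝ :=
  19 * η / 15 * inner ℝ ζ (K ζ) - η / (1 + η * α) * ‖K ζ‖ ^ 2

/-- The Lyapunov function; `e` is the error of the primal iterate and `H` is the value at `u_f` of the Bregman divergence to the solution. -/
noncomputable def potential (τ η α : ℝ) (K : E →ₗ[ℝ] E) (e ζ : E) (H : ℝ) : ℝ :=
  (1 + τ / 12) * (1 / η * ‖e‖ ^ 2 + dualPotential η α K ζ) + (2 - τ) / τ * H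

theorem dualPotential_nonneg {η α : ℝ} (hη : 0 < η) (hα : 0 < α) {K : E →ₗ[ℝ] E}
    (hK : WellConditioned (11 / 15) (19 / 15) K) (ζ : E) : 0 ≤ dualPotential η α K ζ := by
  have h1 := hK.upper ζ
  have h2 : η / (1 + η * α) ≤ η := div_le_self hη.le (by nlinarith [mul_pos hη hα])
  have h3 := mul_le_mul_of_nonneg_right h2 (sq_nonneg ‖K ζ‖)
  unfold dualPotential
  nlinarith [mul_le_mul_of_nonneg_left h1 hη.le]

theorem dualPotential_le {η α : ℝ} (hη : 0 < η) (hα : 0 < α) {K : E →ₗ[ℝ] E}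
    (hK : WellConditioned (11 / 15) (19 / 15) K) (ζ : E) :
    dualPotential η α K ζ ≤ 19 / 11 * η * ‖K ζ‖ ^ 2 := by
  have h1 := hK.lower ζ
  have h2 : 0 ≤ η / (1 + η * α) * ‖K ζ‖ ^ 2 := by positivity
  unfold dualPotential
  nlinarith [mul_le_mul_of_nonneg_left h1 hη.le]

theorem le_potential {τ η α H : ℝ} (hτ : 0 < τ) (hτ1 : τ ≤ 1) (hη : 0 < η) (hα : 0 < α)
    {K : E →ₗ[ℝ] E} (hK : WellConditioned (11 / 15) (19 / 15) K) (e ζ : E) (hH : 0 ≤ H) :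
    1 / η * ‖e‖ ^ 2 ≤ potential τ η α K e ζ H := by
  have h1 := dualPotential_nonneg hη hα hK ζ
  have h2 : 0 ≤ 1 / η * ‖e‖ ^ 2 := by positivity
  have h3 : 0 ≤ (2 - τ) / τ * H := by
    have : 0 ≤ 2 - τ := by linarith
    positivity
  unfold potential
  nlinarith [mul_nonneg hτ.le h1, mul_nonneg hτ.le h2]

/-- The change of the dual potential in one step `ζ' = ζ + θ (d + c K (ζ' - ζ))`, where
`c = η / (1 + η α)` and `d` is the new primal error. -/
theorem dualPotential_step {η α : ℝ} (hη : 0 < η) (hα : 0 < α) {K : E →ₗ[ℝ] E}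
    (hK : WellConditioned (11 / 15) (19 / 15) K) {ζ ζ' d : E}
    (hζ : (19 * η / 15) • (ζ' - ζ) = d + (η / (1 + η * α)) • (K ζ' - K ζ)) :
    dualPotential η α K ζ' ≤ dualPotential η α K ζ + 2 * inner ℝ d (K ζ') := by
  have h1 := hK.upper (ζ' - ζ)
  have h2 : η / (1 + η * α) ≤ η := div_le_self hη.le (by nlinarith [mul_pos hη hα])
  have h3 := mul_le_mul_of_nonneg_right h2 (sq_nonneg ‖K (ζ' - ζ)‖)
  have h4 := congrArg (fun v => inner ℝ v (K ζ')) hζ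
  simp only [inner_smul_left, inner_add_left, inner_sub_left, real_inner_self_eq_norm_sq,
    conj_trivial] at h4
  have h5 := mul_le_mul_of_nonneg_left h1 hη.le
  have h6 : inner ℝ ζ (K ζ') = inner ℝ ζ' (K ζ) := by
    rw [← hK.symm, real_inner_comm]
  rw [map_sub, norm_sub_sq_real, inner_sub_left, inner_sub_right, inner_sub_right, h6] at h5
  rw [map_sub, norm_sub_sq_real] at h3
  rw [h6, real_inner_comm (K ζ') (K ζ)] at h4
  unfold dualPotential
  set c := η / (1 + η * α)
  linarith

/-- Cocoercivity: a convex function with `L`-Lipschitz gradient `g` that is bounded below by `0`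
satisfies `‖g w‖ ^ 2 ≤ 2 L H w`. -/
theorem norm_sq_le_of_smooth {L : ℝ} (hL : 0 < L) {H : E → ℝ} {g : E → E} (h0 : ∀ v, 0 ≤ H v)
    (hsm : ∀ v w, H v ≤ H w + inner ℝ (g w) (v - w) + L / 2 * ‖v - w‖ ^ 2) (w : E) :
    ‖g w‖ ^ 2 ≤ 2 * L * H w := by
  have h := (h0 _).trans (hsm (w - L⁻¹ • g w) w)
  rw [show w - L⁻¹ • g w - w = -(L⁻¹ • g w) by abel, inner_neg_right, inner_smul_right, norm_neg,
    norm_smul, real_inner_self_eq_norm_sq, Real.norm_of_nonneg (inv_pos.2 hL).le, mul_pow] at h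
  have h' := mul_le_mul_of_nonneg_left h (by linarith : 0 ≤ 2 * L)
  field_simp at h'
  nlinarith

/-- Convexity between `u_g` and `u_f`, smoothness between `u_g` and `u_f'` and strong convexity
between `u_g` and the solution, combined with the momentum weights. Here `w2 = ‖u' - u‖ ^ 2`,
`n2 = ‖u_g - u*‖ ^ 2`, and `dg`, `wg`, `ng`, `fg` are the inner products of the gradient at `u_g`
with `u' - u*`, `u' - u`, `u_g - u*` and `u_f - u_g`. -/
theorem momentum_bound {τ η α L w2 n2 dg wg ng fg Hg Hf Hf' : ℝ} (hτ : 0 < τ) (hτ1 : τ ≤ 1)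
    (hη : 0 < η) (hLη : 4 * τ * L * η = 1) (hw0 : 0 ≤ w2)
    (hin : fg * (1 - τ) = τ * (ng - dg + wg)) (hsc : Hg + -ng + α / 2 * n2 ≤ 0)
    (hc : Hg + fg ≤ Hf)
    (hs : Hf' ≤ Hg + 2 * τ / (2 - τ) * wg + L / 2 * ((2 * τ / (2 - τ)) ^ 2 * w2)) :
    -2 * dg ≤ -α * n2 - Hg + (2 - 2 * τ) / τ * Hf - (2 - τ) / τ * Hf' + 1 / (2 * η) * w2 := by
  have h2τ : 0 < 2 - τ := by linarith
  have h1 := mul_le_mul_of_nonneg_left hs (div_nonneg h2τ.le hτ.le)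
  have h2 := mul_le_mul_of_nonneg_left hc
    (div_nonneg (by linarith : 0 ≤ 2 - 2 * τ) hτ.le)
  have e1 : (2 - τ) / τ * (Hg + 2 * τ / (2 - τ) * wg + L / 2 * ((2 * τ / (2 - τ)) ^ 2 * w2))
      = (2 - τ) / τ * Hg + 2 * wg + 2 * L * τ / (2 - τ) * w2 := by
    field_simp
  have e2 : (2 - 2 * τ) / τ * fg = 2 * (ng - dg + wg) := by
    field_simp; linarith
  have e3 : 2 * L * τ / (2 - τ) * w2 ≤ 1 / (2 * η) * w2 := by
    refine mul_le_mul_of_nonneg_right ?_ hw0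
    rw [div_le_div_iff₀ h2τ (by positivity)]
    nlinarith
  have e4 : (2 - 2 * τ) / τ * Hg = (2 - τ) / τ * Hg - Hg := by field_simp; ring
  linarith

/-- The decrease terms of one iteration pay for the factor `1 + τ / 12` on the primal-dual part:
`k2` is the squared dual error, which the optimality condition of the primal step bounds by the
squares `w2`, `m2` of `u' - u`, `u' - u_g` and the square `g2` of the gradient at `u_g`; `d2` is the
squared primal error. -/
theorem surplus_bound {τ η α L d2 w2 m2 g2 k2 Q' Hg : ℝ} (hτ : 0 < τ) (hτ1 : τ ≤ 1)
    (hη : 0 < η) (hα : 0 < α) (hLη : 4 * τ * L * η = 1) (hηα : η * α = 15 / 19 * τ)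
    (hd0 : 0 ≤ d2) (hw0 : 0 ≤ w2) (hm0 : 0 ≤ m2) (hHg : 0 ≤ Hg) (hg : g2 ≤ 2 * L * Hg)
    (hQ' : Q' ≤ 19 / 11 * η * k2)
    (hbound : k2 ≤ 3 * ((1 / η) ^ 2 * w2 + g2 + α ^ 2 * m2)) :
    τ / 12 * (1 / η * d2 + Q') ≤ α * d2 + 1 / (2 * η) * w2 + α * m2 + Hg := by
  have e1 : τ / 12 * (1 / η * d2) ≤ α * d2 := by
    have : α = 15 / 19 * τ * (1 / η) := by field_simp; linarith
    have h' : 0 ≤ τ * (1 / η) * d2 := by positivity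
    rw [this]
    linarith
  have e2 : τ / 12 * Q'
      ≤ 57 / 132 * (τ * η) * ((1 / η) ^ 2 * w2 + g2 + α ^ 2 * m2) := by
    have := mul_le_mul_of_nonneg_left hbound (by positivity : 0 ≤ τ / 12 * (19 / 11 * η))
    have := mul_le_mul_of_nonneg_left hQ' (by positivity : 0 ≤ τ / 12)
    linarith
  have e3 : 57 / 132 * (τ * η) * ((1 / η) ^ 2 * w2) ≤ 1 / (2 * η) * w2 := by
    have e : 57 / 132 * (τ * η) * ((1 / η) ^ 2 * w2) = 114 / 132 * τ * (1 / (2 * η) * w2) := by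
      field_simp; ring
    rw [e]
    exact mul_le_of_le_one_left (by positivity) (by linarith)
  have e4 : 57 / 132 * (τ * η) * g2 ≤ Hg := by
    have := mul_le_mul_of_nonneg_left hg (by positivity : 0 ≤ τ * η)
    have e : τ * η * (2 * L * Hg) = Hg / 2 := by linear_combination Hg / 2 * hLη
    linarith
  have e5 : 57 / 132 * (τ * η) * (α ^ 2 * m2) ≤ α * m2 := by
    have e : 57 / 132 * (τ * η) * (α ^ 2 * m2)
        = 57 / 132 * (15 / 19) * (τ * τ) * (α * m2) := by
      linear_combination 57 / 132 * τ * α * m2 * hηα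
    rw [e]
    refine mul_le_of_le_one_left (by positivity) ?_
    nlinarith
  linarith

/-- One iteration, written in terms of the errors `u - us` and `z - zs = K ζ`, contracts the
potential by the factor `1 + τ / 12`. Here `H` is the Bregman divergence of the objective to the
solution `us` and `g` is its gradient; strong convexity enters only between `us` and the
extrapolated point `ug`. -/
theorem potential_step {τ η α L : ℝ} (hτ : 0 < τ) (hτ1 : τ ≤ 1) (hη : 0 < η) (hα : 0 < α)
    (hαL : α ≤ L) (hLη : 4 * τ * L * η = 1) (hηα : η * α = 15 / 19 * τ)
    {K : E →ₗ[ℝ] E} (hK : WellConditioned (11 / 15) (19 / 15) K) {H : E → ℝ} {g : E → E}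
    (h0 : ∀ v, 0 ≤ H v) (hconv : ∀ v w, H w + inner ℝ (g w) (v - w) ≤ H v)
    (hsm : ∀ v w, H v ≤ H w + inner ℝ (g w) (v - w) + L / 2 * ‖v - w‖ ^ 2)
    {us u uf ug uh u' uf' ζ ζ' : E}
    (hsc : H ug + inner ℝ (g ug) (us - ug) + α / 2 * ‖us - ug‖ ^ 2 ≤ 0)
    (hug : ug = τ • u + (1 - τ) • uf)
    (huh : uh = (1 + η * α)⁻¹ • (u - η • (g ug - α • ug + K ζ)))
    (hζ' : ζ' = ζ + (15 / (19 * η)) • (uh - us))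
    (hu' : u' = (1 + η * α)⁻¹ • (u - η • (g ug - α • ug + K ζ')))
    (huf' : uf' = ug + (2 * τ / (2 - τ)) • (u' - u)) :
    (1 + τ / 12) * potential τ η α K (u' - us) ζ' (H uf')
      ≤ potential τ η α K (u - us) ζ (H uf) := by
  have hηα0 : 0 < 1 + η * α := by positivity
  have hL : 0 < L := hα.trans_le hαL
  have h2τ : 0 < 2 - τ := by linarith
  -- The optimality condition of the implicit primal step.
  have hk' : K ζ' = -((1 / η) • (u' - u)) - g ug - α • (u' - ug) := by
    have h : (1 + η * α) • u' = u - η • (g ug - α • ug + K ζ') := by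
      rw [hu', smul_smul, mul_inv_cancel₀ hηα0.ne', one_smul]
    have h' : η • K ζ' = η • (-((1 / η) • (u' - u)) - g ug - α • (u' - ug)) := by
      have : η • K ζ' = u - η • (g ug - α • ug) - (1 + η * α) • u' := by rw [h]; module
      rw [this]
      match_scalars <;> field_simp
      ring
    exact smul_right_injective E hη.ne' h'
  have hdual : (19 * η / 15) • (ζ' - ζ) = (u' - us) + (η / (1 + η * α)) • (K ζ' - K ζ) := by
    have h : uh = u' + (η / (1 + η * α)) • (K ζ' - K ζ) := by
      rw [huh, hu']; match_scalars <;> field_simp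
      ring
    have h1 : ζ' - ζ = (15 / (19 * η)) • (uh - us) := by rw [hζ']; abel
    rw [h1, h]
    match_scalars <;> field_simp
  have hQ := dualPotential_step hη hα hK hdual
  have hQ' := dualPotential_le hη hα hK ζ'
  have hg := norm_sq_le_of_smooth hL h0 hsm ug
  have hHuf := h0 uf
  -- Convexity and smoothness along the momentum step.
  have hc := hconv uf ug
  have hs := hsm uf' ug
  have huf'' : uf' - ug = (2 * τ / (2 - τ)) • (u' - u) := by rw [huf']; abel
  rw [huf'', norm_smul, inner_smul_right, mul_pow, Real.norm_eq_abs, sq_abs] at hs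
  have hin : inner ℝ (g ug) (uf - ug) * (1 - τ)
      = τ * (inner ℝ (g ug) (ug - us) - inner ℝ (g ug) (u' - us)
        + inner ℝ (g ug) (u' - u)) := by
    have hv : (1 - τ) • (uf - ug) = τ • ((ug - us) - (u' - us) + (u' - u)) := by
      have : (1 - τ) • uf = ug - τ • u := by rw [hug]; abel
      rw [smul_sub, this]; module
    have := congrArg (fun v => inner ℝ (g ug) v) hv
    simp only [inner_smul_right, inner_add_right, inner_sub_right] at this ⊢
    linarith
  have hrev : us - ug = -(ug - us) := by abel
  rw [hrev, inner_neg_right, norm_neg] at hsc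
  have hbound : ‖K ζ'‖ ^ 2
      ≤ 3 * ((1 / η) ^ 2 * ‖u' - u‖ ^ 2 + ‖g ug‖ ^ 2 + α ^ 2 * ‖u' - ug‖ ^ 2) := by
    have h1 : ‖K ζ'‖ ≤ (1 / η) * ‖u' - u‖ + ‖g ug‖ + α * ‖u' - ug‖ := by
      rw [hk']
      refine (norm_sub_le _ _).trans ?_
      refine (add_le_add_left (norm_sub_le _ _) _).trans ?_
      rw [norm_neg, norm_smul, norm_smul, Real.norm_of_nonneg hα.le,
        Real.norm_of_nonneg (by positivity)]
    have h2 := pow_le_pow_left₀ (norm_nonneg _) h1 2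
    nlinarith [sq_nonneg ((1 / η) * ‖u' - u‖ - ‖g ug‖), sq_nonneg (‖g ug‖ - α * ‖u' - ug‖),
      sq_nonneg ((1 / η) * ‖u' - u‖ - α * ‖u' - ug‖)]
  -- The inner products with the new primal error.
  have hexp : ∀ d w v m : E, inner ℝ d (-((1 / η) • w) - v - α • m)
      = -(1 / η * inner ℝ d w) - inner ℝ d v - α * inner ℝ d m := by
    intro d w v m
    simp only [inner_sub_right, inner_neg_right, inner_smul_right]
  have hd := hexp (u' - us) (u' - u) (g ug) (u' - ug)
  rw [← hk'] at hd
  have he : ‖u - us‖ ^ 2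
      = ‖u' - us‖ ^ 2 - 2 * inner ℝ (u' - us) (u' - u) + ‖u' - u‖ ^ 2 := by
    rw [← norm_sub_sq_real]; congr 2; abel
  have hn : ‖ug - us‖ ^ 2
      = ‖u' - us‖ ^ 2 - 2 * inner ℝ (u' - us) (u' - ug) + ‖u' - ug‖ ^ 2 := by
    rw [← norm_sub_sq_real]; congr 2; abel
  rw [real_inner_comm (g ug) (u' - us)] at hd
  have hw0 := sq_nonneg ‖u' - u‖
  have hm0 := sq_nonneg ‖u' - ug‖
  have hd0 := sq_nonneg ‖u' - us‖
  have hHg := h0 ug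
  unfold potential
  generalize ‖u' - u‖ ^ 2 = w2 at *
  generalize ‖u' - ug‖ ^ 2 = m2 at *
  generalize ‖u' - us‖ ^ 2 = d2 at *
  generalize ‖u - us‖ ^ 2 = e2 at *
  generalize ‖ug - us‖ ^ 2 = n2 at *
  generalize ‖g ug‖ ^ 2 = g2 at *
  generalize ‖K ζ'‖ ^ 2 = k2 at *
  generalize inner ℝ (u' - us) (K ζ') = dk at *
  generalize inner ℝ (u' - us) (u' - u) = dw at *
  generalize inner ℝ (u' - us) (u' - ug) = dm at *
  generalize inner ℝ (g ug) (u' - us) = dg at *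
  generalize inner ℝ (g ug) (u' - u) = wg at *
  generalize inner ℝ (g ug) (ug - us) = ng at *
  generalize inner ℝ (g ug) (uf - ug) = fg at *
  generalize dualPotential η α K ζ' = Q' at *
  generalize dualPotential η α K ζ = Q at *
  generalize H ug = Hg at *
  generalize H uf = Hf at *
  generalize H uf' = Hf' at *
  have hgrad := momentum_bound hτ hτ1 hη hLη hw0 hin hsc hc hs
  have hmain : 1 / η * d2 + Q' + α * d2 + (2 - τ) / τ * Hf'
      ≤ 1 / η * e2 + Q + (2 - 2 * τ) / τ * Hf - 1 / (2 * η) * w2 - α * m2 - Hg := by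
    have e1 : 1 / η * e2 = 1 / η * d2 - 2 * (1 / η * dw) + 1 / η * w2 := by rw [he]; ring
    have e2 : α * n2 = α * d2 - 2 * (α * dm) + α * m2 := by rw [hn]; ring
    have e3 : 1 / (2 * η) * w2 = 1 / η * w2 / 2 := by field_simp
    linarith
  have hsurplus := surplus_bound hτ hτ1 hη hα hLη hηα hd0 hw0 hm0 hHg hg hQ' hbound
  have hcombine : (1 + τ / 12) * (1 / η * d2 + Q') + (2 - τ) / τ * Hf'
      ≤ 1 / η * e2 + Q + (2 - 2 * τ) / τ * Hf := by linarith
  have hrate : (1 + τ / 12) * ((2 - 2 * τ) / τ * Hf) ≤ (2 - τ) / τ * Hf := by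
    rw [← mul_assoc]
    refine mul_le_mul_of_nonneg_right ?_ hHuf
    rw [mul_div_assoc', div_le_div_iff_of_pos_right hτ]
    nlinarith
  have := mul_le_mul_of_nonneg_left hcombine (by positivity : 0 ≤ 1 + τ / 12)
  linarith

end Lyapunov

/-! ### The block operators -/

section Blocks

variable {n m : ℕ} {d : Fin n → ℕ}

/-- `applyA` as a linear map. -/
noncomputable def linA (A : ∀ i, Matrix (Fin m) (Fin (d i)) ℝ) : Primal n d →ₗ[ℝ] Blocks n m where
  toFun := applyA A
  map_add' x y := by ext i j; simp [applyA, Matrix.mulVec_add]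
  map_smul' c x := by ext i j; simp [applyA, Matrix.mulVec_smul]

/-- `applyAT` as a linear map. -/
noncomputable def linAT (A : ∀ i, Matrix (Fin m) (Fin (d i)) ℝ) :
    Blocks n m →ₗ[ℝ] Primal n d where
  toFun := applyAT A
  map_add' x y := by ext i j; simp [applyAT, Matrix.mulVec_add]
  map_smul' c x := by ext i j; simp [applyAT, Matrix.mulVec_smul]

/-- `applyW` as a linear map. -/
noncomputable def linW (W : Matrix (Fin n) (Fin n) ℝ) : Blocks n m →ₗ[ℝ] Blocks n m where
  toFun := applyW W
  map_add' x y := by ext i j; simp [applyW, Finset.sum_add_distrib]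
  map_smul' c x := by
    ext i j
    simp only [applyW, PiLp.smul_apply, WithLp.ofLp_sum, Finset.sum_apply, RingHom.id_apply,
      WithLp.ofLp_smul, Pi.smul_apply, smul_eq_mul, Finset.mul_sum]
    exact Finset.sum_congr rfl fun j _ => by ring

theorem inner_mulVec {k : ℕ} (B : Matrix (Fin m) (Fin k) ℝ) (v : EuclideanSpace ℝ (Fin k))
    (w : EuclideanSpace ℝ (Fin m)) :
    inner ℝ (WithLp.toLp 2 (B *ᵥ v.ofLp)) w = inner ℝ v (WithLp.toLp 2 (Bᵀ *ᵥ w.ofLp)) := by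
  simp only [EuclideanSpace.inner_eq_star_dotProduct, star_trivial, Matrix.dotProduct_mulVec,
    Matrix.mulVec_transpose]

theorem inner_linA (A : ∀ i, Matrix (Fin m) (Fin (d i)) ℝ) (x : Primal n d) (y : Blocks n m) :
    inner ℝ (linA A x) y = inner ℝ x (linAT A y) := by
  rw [PiLp.inner_apply, PiLp.inner_apply]
  exact Finset.sum_congr rfl fun i _ => inner_mulVec (A i) (x i) (y i)

theorem linW_apply_coord (W : Matrix (Fin n) (Fin n) ℝ) (y : Blocks n m) (i : Fin n) (c : Fin m) :
    linW W y i c = (W *ᵥ fun j => y j c) i := by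
  simp [linW, applyW, Matrix.mulVec, dotProduct]

theorem isSymmetric_linW {W : Matrix (Fin n) (Fin n) ℝ} (hW : W.IsHermitian) :
    (linW (m := m) W).IsSymmetric := by
  intro x y
  simp only [linW, LinearMap.coe_mk, AddHom.coe_mk, applyW, PiLp.inner_apply (𝕜 := ℝ) (ι := Fin n),
    sum_inner, inner_sum, inner_smul_left, inner_smul_right, conj_trivial]
  rw [Finset.sum_comm]
  refine Finset.sum_congr rfl fun i _ => Finset.sum_congr rfl fun j _ => ?_
  rw [← hW.apply i j]
  simp

/-- The element of `(ℝ^m)^n` with all blocks equal to `c`. -/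
noncomputable def consensus (n : ℕ) (c : EuclideanSpace ℝ (Fin m)) : Blocks n m :=
  WithLp.toLp 2 fun _ => c

/-- The sum of the blocks, so that the coupled constraint reads `sumBlocks (A x - b) = 0`. -/
noncomputable def sumBlocks (n m : ℕ) : Blocks n m →ₗ[ℝ] EuclideanSpace ℝ (Fin m) where
  toFun y := ∑ i, y i
  map_add' x y := by simp [Finset.sum_add_distrib]
  map_smul' c x := by simp [Finset.smul_sum]

theorem inner_consensus (y : Blocks n m) (c : EuclideanSpace ℝ (Fin m)) :
    inner ℝ y (consensus n c) = inner ℝ (sumBlocks n m y) c := by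
  have h : sumBlocks n m y = ∑ i, y i := rfl
  rw [PiLp.inner_apply, h, sum_inner]
  rfl

theorem linW_eq_zero_iff {W : Matrix (Fin n) (Fin n) ℝ}
    (hker : ∀ y : Fin n → ℝ, W *ᵥ y = 0 ↔ ∀ i j, y i = y j) (y : Blocks n m) :
    linW W y = 0 ↔ ∃ c, y = consensus n c := by
  constructor
  · intro h
    have hc : ∀ i j, y i = y j := by
      intro i j
      ext c
      refine (hker fun j => y j c).1 ?_ i j
      ext i
      rw [← linW_apply_coord, h]
      simp
    rcases n with _ | n
    · exact ⟨0, by ext i; exact i.elim0⟩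
    · exact ⟨y 0, by ext i : 1; simp [consensus, hc i 0]⟩
  · rintro ⟨c, rfl⟩
    ext i a
    rw [linW_apply_coord, (hker _).2 (by simp [consensus])]
    simp

/-- An eigenvalue of a symmetric real matrix acting on Euclidean space is in its spectrum. -/
theorem mem_spectrum_of_hasEigenvalue_toEuclideanLin {k : ℕ} {S : Matrix (Fin k) (Fin k) ℝ} {t : ℝ}
    (ht : Module.End.HasEigenvalue (Matrix.toEuclideanLin S) t) : t ∈ spectrum ℝ S := by
  rw [← Matrix.spectrum_toLpLin 2]
  exact ht.mem_spectrum

theorem eigenIn_linW {G : SimpleGraph (Fin n)} {L μ : ℝ} {W : Matrix (Fin n) (Fin n) ℝ}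
    (hW : IsGossip G L μ W) : EigenIn (√μ) (√L) (linW (m := m) W) := by
  intro t ht
  obtain ⟨v, hv⟩ := ht.exists_hasEigenvector
  have hv0 := hv.2
  have hvt := hv.apply_eq_smul
  obtain ⟨i, c, hic⟩ : ∃ i c, v i c ≠ 0 := by
    by_contra! h
    exact hv0 (by ext i c; simpa using h i c)
  have hw : W *ᵥ (fun j => v j c) = t • (fun j => v j c) := by
    ext i
    rw [← linW_apply_coord, hvt]
    simp
  have hspec : t ∈ spectrum ℝ W := by
    rw [← Matrix.spectrum_toLin']
    refine (Module.End.hasEigenvalue_of_hasEigenvector (x := fun j => v j c) ⟨?_, ?_⟩).mem_spectrum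
    · rw [Module.End.mem_eigenspace_iff, Matrix.toLin'_apply, hw]
    · exact fun h => hic (congrFun h i)
  by_cases h0 : t = 0
  · exact Or.inl h0
  have ht0 : 0 ≤ t := by
    have h := hW.posSemidef.dotProduct_mulVec_nonneg (fun j => v j c)
    rw [hw, dotProduct_smul, star_trivial, smul_eq_mul] at h
    have hpos : 0 < (fun j => v j c) ⬝ᵥ (fun j => v j c) := by
      refine lt_of_le_of_ne (Finset.sum_nonneg fun j _ => mul_self_nonneg _) fun h => hic ?_
      exact congrFun (dotProduct_self_eq_zero.1 h.symm) i
    exact nonneg_of_mul_nonneg_left h hpos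
  exact Or.inr ⟨Real.sqrt_le_iff.2 ⟨ht0, hW.lower t hspec h0⟩,
    Real.le_sqrt_of_sq_le (hW.upper t hspec)⟩

theorem norm_mulVec_sq_le {k : ℕ} {B : Matrix (Fin m) (Fin k) ℝ} {L : ℝ}
    (hB : ∀ t ∈ spectrum ℝ (Bᵀ * B), t ≤ L) (v : EuclideanSpace ℝ (Fin k)) :
    ‖WithLp.toLp 2 (B *ᵥ v.ofLp)‖ ^ 2 ≤ L * ‖v‖ ^ 2 := by
  have hs : (Matrix.toEuclideanLin (Bᵀ * B)).IsSymmetric :=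
    Matrix.isSymmetric_toEuclideanLin_iff.2
      (by simpa using Matrix.isHermitian_conjTranspose_mul_self B)
  have h := inner_aeval_nonneg hs (q := Polynomial.C L - Polynomial.X)
    (fun t ht => by simpa using hB t (mem_spectrum_of_hasEigenvalue_toEuclideanLin ht)) v
  simp only [map_sub, Polynomial.aeval_C, Polynomial.aeval_X, LinearMap.sub_apply,
    Module.algebraMap_end_eq_smul_id, LinearMap.smul_apply, LinearMap.id_apply, inner_sub_right,
    inner_smul_right, real_inner_self_eq_norm_sq] at h
  have e : ‖WithLp.toLp 2 (B *ᵥ v.ofLp)‖ ^ 2 = inner ℝ v (Matrix.toEuclideanLin (Bᵀ * B) v) := by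
    rw [← real_inner_self_eq_norm_sq, inner_mulVec, Matrix.toLpLin_apply,
      ← Matrix.mulVec_mulVec]
  linarith

theorem norm_linA_sq_le {L : ℝ} {A : ∀ i, Matrix (Fin m) (Fin (d i)) ℝ}
    (hA : ∀ i, ∀ t ∈ spectrum ℝ ((A i)ᵀ * A i), t ≤ L) (x : Primal n d) :
    ‖linA A x‖ ^ 2 ≤ L * ‖x‖ ^ 2 := by
  rw [PiLp.norm_sq_eq_of_L2, PiLp.norm_sq_eq_of_L2, Finset.mul_sum]
  exact Finset.sum_le_sum fun i _ => norm_mulVec_sq_le (hA i) (x i)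

/-- On the orthogonal complement of the common kernel of the `A_iᵀ`, the adjoint of `A` is bounded
below on consensus vectors. -/
theorem norm_linAT_consensus_sq_ge {μ : ℝ} {A : ∀ i, Matrix (Fin m) (Fin (d i)) ℝ}
    (hA : ∀ t ∈ spectrum ℝ (matS A), 0 < t → μ ≤ t) (c : EuclideanSpace ℝ (Fin m))
    (hc : ∀ v, linAT A (consensus n v) = 0 → inner ℝ c v = 0) :
    μ * ‖consensus n c‖ ^ 2 ≤ ‖linAT A (consensus n c)‖ ^ 2 := by
  rcases Nat.eq_zero_or_pos n with rfl | hn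
  · simp [PiLp.norm_sq_eq_of_L2]
  have hn' : (0 : ℝ) < n := by exact_mod_cast hn
  have key : ∀ v, ‖linAT A (consensus n v)‖ ^ 2
      = n * inner ℝ v (Matrix.toEuclideanLin (matS A) v) := by
    intro v
    have h : ∀ i, ‖linAT A (consensus n v) i‖ ^ 2
        = inner ℝ v (WithLp.toLp 2 ((A i * (A i)ᵀ) *ᵥ v.ofLp)) := by
      intro i
      rw [← Matrix.mulVec_mulVec, ← real_inner_self_eq_norm_sq, real_inner_comm]
      have := inner_mulVec (A i)ᵀ v (WithLp.toLp 2 ((A i)ᵀ *ᵥ v.ofLp))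
      rw [Matrix.transpose_transpose] at this
      exact this
    rw [PiLp.norm_sq_eq_of_L2, Finset.sum_congr rfl fun i _ => h i, ← inner_sum,
      ← inner_smul_right]
    congr 1
    ext j
    simp only [WithLp.ofLp_sum, Matrix.toLpLin_apply, matS, Matrix.smul_mulVec,
      Matrix.sum_mulVec, Finset.sum_apply, PiLp.smul_apply, smul_eq_mul, Pi.smul_apply]
    field_simp
  have hs : (Matrix.toEuclideanLin (matS A)).IsSymmetric := by
    refine Matrix.isSymmetric_toEuclideanLin_iff.2 ?_
    simp [matS, Matrix.IsHermitian, Matrix.transpose_sum]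
  have h := inner_ge_of_orthogonal_ker hs (μ := μ) (fun t ht => ?_) c (fun w hw => hc w ?_)
  · rw [key, PiLp.norm_sq_eq_of_L2]
    simp only [consensus, Finset.sum_const, Finset.card_univ, Fintype.card_fin, nsmul_eq_mul]
    nlinarith
  · by_cases h0 : t = 0
    · exact Or.inl h0
    refine Or.inr (hA t (mem_spectrum_of_hasEigenvalue_toEuclideanLin ht)
      (lt_of_le_of_ne ?_ (Ne.symm h0)))
    obtain ⟨v, hv⟩ := ht.exists_hasEigenvector
    have h1 := key v
    rw [hv.apply_eq_smul, inner_smul_right, real_inner_self_eq_norm_sq] at h1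
    have h2 : 0 < ‖v‖ ^ 2 := by have := norm_pos_iff.2 hv.2; positivity
    have h3 : 0 ≤ t * (n * ‖v‖ ^ 2) := by nlinarith [sq_nonneg ‖linAT A (consensus n v)‖]
    exact nonneg_of_mul_nonneg_left h3 (by positivity)
  · have h1 := key w
    rw [hw, inner_zero_right, mul_zero] at h1
    simpa using h1

end Blocks

/-! ### The stacked operator `B = [A, γ W']` and the augmented objective -/

section Stacked

variable {X Y : Type} [NormedAddCommGroup X] [InnerProductSpace ℝ X]
  [NormedAddCommGroup Y] [InnerProductSpace ℝ Y]

/-- The operator `B (x, y) = A x + γ W' y` on the Euclidean product. -/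
noncomputable def mapB (A : X →ₗ[ℝ] Y) (Wp : Y →ₗ[ℝ] Y) (γ : ℝ) : WithLp 2 (X × Y) →ₗ[ℝ] Y where
  toFun u := A u.fst + γ • Wp u.snd
  map_add' u v := by simp only [WithLp.add_fst, WithLp.add_snd, map_add, smul_add]; abel
  map_smul' c u := by
    simp only [WithLp.smul_fst, WithLp.smul_snd, map_smul, smul_add, RingHom.id_apply,
      smul_comm c γ]

/-- The adjoint `q ↦ (Aᵀ q, γ W' q)` of `mapB`. -/
noncomputable def mapBT (AT : Y →ₗ[ℝ] X) (Wp : Y →ₗ[ℝ] Y) (γ : ℝ) :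
    Y →ₗ[ℝ] WithLp 2 (X × Y) where
  toFun q := WithLp.toLp 2 (AT q, γ • Wp q)
  map_add' u v := by rw [← WithLp.toLp_add]; simp
  map_smul' c u := by rw [RingHom.id_apply, ← WithLp.toLp_smul]; simp [smul_comm c γ]

variable {A : X →ₗ[ℝ] Y} {AT : Y →ₗ[ℝ] X} {Wp : Y →ₗ[ℝ] Y} {γ : ℝ}

theorem inner_mapB (hA : ∀ x y, inner ℝ (A x) y = inner ℝ x (AT y)) (hW : Wp.IsSymmetric)
    (u : WithLp 2 (X × Y)) (q : Y) :
    inner ℝ (mapB A Wp γ u) q = inner ℝ u (mapBT AT Wp γ q) := by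
  simp only [mapB, mapBT, LinearMap.coe_mk, AddHom.coe_mk, WithLp.prod_inner_apply, inner_add_left,
    inner_smul_left, inner_smul_right, hA, hW u.snd q, conj_trivial]
  rfl

theorem isSymmetric_normal (hA : ∀ x y, inner ℝ (A x) y = inner ℝ x (AT y))
    (hW : Wp.IsSymmetric) : (mapBT AT Wp γ ∘ₗ mapB A Wp γ).IsSymmetric := by
  intro u v
  rw [LinearMap.comp_apply, LinearMap.comp_apply, ← inner_mapB hA hW, real_inner_comm,
    ← inner_mapB hA hW, real_inner_comm]

theorem norm_mapB_sq_le {LA l : ℝ} (hLA : 0 < LA) (hγ : 0 < γ) (hl : 0 < l)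
    (hA : ∀ x, ‖A x‖ ^ 2 ≤ LA * ‖x‖ ^ 2) (hW : ∀ y, ‖Wp y‖ ^ 2 ≤ l * ‖y‖ ^ 2)
    (u : WithLp 2 (X × Y)) : ‖mapB A Wp γ u‖ ^ 2 ≤ (LA + γ ^ 2 * l) * ‖u‖ ^ 2 := by
  have h1 : ‖mapB A Wp γ u‖ ≤ ‖A u.fst‖ + γ * ‖Wp u.snd‖ := by
    refine (norm_add_le _ _).trans ?_
    rw [norm_smul, Real.norm_of_nonneg hγ.le]
  have h2 := pow_le_pow_left₀ (norm_nonneg _) h1 2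
  have hx := hA u.fst
  have hy := mul_le_mul_of_nonneg_left (hW u.snd) (sq_nonneg γ)
  refine h2.trans ?_
  rw [WithLp.prod_norm_sq_eq_of_L2]
  -- Cauchy–Schwarz with the weights `LA` and `γ ^ 2 * l`.
  have ha := norm_nonneg (A u.fst)
  have hb := norm_nonneg (Wp u.snd)
  have hp : 0 < γ ^ 2 * l := by positivity
  set a := ‖A u.fst‖
  set b := ‖Wp u.snd‖
  have h3 : a ^ 2 / LA ≤ ‖u.fst‖ ^ 2 := by rw [div_le_iff₀ hLA]; linarith
  have h4 : (γ * b) ^ 2 / (γ ^ 2 * l) ≤ ‖u.snd‖ ^ 2 := by rw [div_le_iff₀ hp]; nlinarith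
  refine le_trans ?_ (mul_le_mul_of_nonneg_left (add_le_add h3 h4) (by positivity))
  rw [← sub_nonneg]
  have : (LA + γ ^ 2 * l) * (a ^ 2 / LA + (γ * b) ^ 2 / (γ ^ 2 * l)) - (a + γ * b) ^ 2
      = (γ ^ 2 * l * a - LA * (γ * b)) ^ 2 / (LA * (γ ^ 2 * l)) := by
    field_simp; ring
  rw [this]
  positivity

/-- `BᵀB` has the same nonzero eigenvalues as `BBᵀ`; so it is enough to bound `Bᵀ` from below on
the orthogonal complement of its kernel. -/
theorem eigenIn_normal {μ L : ℝ} (hA : ∀ x y, inner ℝ (A x) y = inner ℝ x (AT y))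
    (hW : Wp.IsSymmetric) (hup : ∀ u, ‖mapB A Wp γ u‖ ^ 2 ≤ L * ‖u‖ ^ 2)
    (hlow : ∀ y, (∀ w, mapBT AT Wp γ w = 0 → inner ℝ y w = 0) →
      μ * ‖y‖ ^ 2 ≤ ‖mapBT AT Wp γ y‖ ^ 2) :
    EigenIn μ L (mapBT AT Wp γ ∘ₗ mapB A Wp γ) := by
  intro t ht
  obtain ⟨v, hv⟩ := ht.exists_hasEigenvector
  have hvt : mapBT AT Wp γ (mapB A Wp γ v) = t • v := hv.apply_eq_smul
  have hnorm : ‖mapB A Wp γ v‖ ^ 2 = t * ‖v‖ ^ 2 := by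
    rw [← real_inner_self_eq_norm_sq, inner_mapB hA hW, hvt, inner_smul_right,
      real_inner_self_eq_norm_sq]
  have hv0 : 0 < ‖v‖ ^ 2 := by have := norm_pos_iff.2 hv.2; positivity
  by_cases h0 : t = 0
  · exact Or.inl h0
  refine Or.inr ⟨?_, ?_⟩
  · have ht0 : 0 < t := lt_of_le_of_ne
      (nonneg_of_mul_nonneg_left (hnorm ▸ sq_nonneg ‖mapB A Wp γ v‖) hv0) (Ne.symm h0)
    have h := hlow (mapB A Wp γ v) fun w hw => by rw [inner_mapB hA hW, hw, inner_zero_right]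
    rw [hvt, norm_smul, mul_pow, Real.norm_eq_abs, sq_abs, hnorm] at h
    have : μ * (t * ‖v‖ ^ 2) ≤ t * (t * ‖v‖ ^ 2) := by linarith
    exact le_of_mul_le_mul_right this (by positivity)
  · have := hup v
    rw [hnorm] at this
    exact le_of_mul_le_mul_right this hv0

theorem exists_aeval_normal_eq {φ : Polynomial ℝ} (hφ : φ.eval 0 = 0) (v : WithLp 2 (X × Y)) :
    ∃ q, (Polynomial.aeval (mapBT AT Wp γ ∘ₗ mapB A Wp γ) φ :
      WithLp 2 (X × Y) →ₗ[ℝ] WithLp 2 (X × Y)) v = mapBT AT Wp γ q := by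
  obtain ⟨ψ, rfl⟩ : Polynomial.X ∣ φ := by
    rw [Polynomial.X_dvd_iff, Polynomial.coeff_zero_eq_eval_zero, hφ]
  rw [map_mul, Polynomial.aeval_X]
  exact ⟨_, rfl⟩

/-- The Bregman divergence to `us` of the augmented objective `F(x) + (r / 2) ‖B (x, y) - b‖ ^ 2`,
where `dF` is the gradient of `F`. -/
noncomputable def bregman (F : X → ℝ) (dF : X → X) (r : ℝ) (B : WithLp 2 (X × Y) →ₗ[ℝ] Y)
    (us v : WithLp 2 (X × Y)) : ℝ :=
  F v.fst - F us.fst - inner ℝ (dF us.fst) (v.fst - us.fst) + r / 2 * ‖B (v - us)‖ ^ 2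

/-- The gradient of `bregman`. -/
noncomputable def bregmanGrad (dF : X → X) (r : ℝ) (B : WithLp 2 (X × Y) →ₗ[ℝ] Y)
    (BT : Y →ₗ[ℝ] WithLp 2 (X × Y)) (us v : WithLp 2 (X × Y)) : WithLp 2 (X × Y) :=
  WithLp.toLp 2 (dF v.fst - dF us.fst, 0) + r • BT (B (v - us))

theorem bregman_eq {F : X → ℝ} {dF : X → X} {r : ℝ} {B : WithLp 2 (X × Y) →ₗ[ℝ] Y}
    {BT : Y →ₗ[ℝ] WithLp 2 (X × Y)} (hB : ∀ u q, inner ℝ (B u) q = inner ℝ u (BT q))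
    (us v w : WithLp 2 (X × Y)) :
    bregman F dF r B us v = bregman F dF r B us w + inner ℝ (bregmanGrad dF r B BT us w) (v - w)
      + (F v.fst - F w.fst - inner ℝ (dF w.fst) (v.fst - w.fst) + r / 2 * ‖B (v - w)‖ ^ 2) := by
  have e : B (v - us) = B (v - w) + B (w - us) := by rw [← map_add]; congr 1; abel
  have e1 : v.fst - us.fst = (v.fst - w.fst) + (w.fst - us.fst) := by abel
  unfold bregman bregmanGrad
  rw [e, e1, norm_add_sq_real, inner_add_left, inner_smul_left, real_inner_comm (v - w) (BT _), ← hB,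
    WithLp.prod_inner_apply, inner_add_right]
  simp only [WithLp.ofLp_fst, WithLp.ofLp_snd, WithLp.sub_fst, WithLp.sub_snd, inner_sub_left,
    inner_zero_left, conj_trivial]
  ring

theorem bregman_self {F : X → ℝ} {dF : X → X} {r : ℝ} {B : WithLp 2 (X × Y) →ₗ[ℝ] Y}
    (us : WithLp 2 (X × Y)) : bregman F dF r B us us = 0 := by simp [bregman]

theorem augmented_smooth {LA l κ r : ℝ} (hr : 0 < r) (hA : ∀ x, ‖A x‖ ^ 2 ≤ LA * ‖x‖ ^ 2)
    (hW : ∀ y, ‖Wp y‖ ^ 2 ≤ l * ‖y‖ ^ 2) (h : r * γ ^ 2 * l ≤ κ) (u : WithLp 2 (X × Y)) :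
    r / 2 * ‖mapB A Wp γ u‖ ^ 2 ≤ r * LA * ‖u.fst‖ ^ 2 + κ * ‖u.snd‖ ^ 2 := by
  have h1 : ‖mapB A Wp γ u‖ ^ 2 ≤ 2 * ‖A u.fst‖ ^ 2 + 2 * ‖γ • Wp u.snd‖ ^ 2 := by
    have := pow_le_pow_left₀ (norm_nonneg _) (norm_add_le (A u.fst) (γ • Wp u.snd)) 2
    refine this.trans ?_
    nlinarith [sq_nonneg (‖A u.fst‖ - ‖γ • Wp u.snd‖)]
  rw [norm_smul, mul_pow, Real.norm_eq_abs, sq_abs] at h1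
  have h2 := mul_le_mul_of_nonneg_left (hA u.fst) hr.le
  have h3 := mul_le_mul_of_nonneg_left (hW u.snd) (by positivity : 0 ≤ r * γ ^ 2)
  have h4 := mul_le_mul_of_nonneg_right h (sq_nonneg ‖u.snd‖)
  have h5 := mul_le_mul_of_nonneg_left h1 (by positivity : 0 ≤ r / 2)
  linarith

/-- The augmentation term is strongly convex in `y`, up to a loss in `x`, along differences whose
second component lies in the range of `W'`. -/
theorem augmented_strong {LA l κ r : ℝ} (hr : 0 < r) (hA : ∀ x, ‖A x‖ ^ 2 ≤ LA * ‖x‖ ^ 2)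
    (hW : ∀ y, l * ‖Wp y‖ ^ 2 ≤ ‖Wp (Wp y)‖ ^ 2) (h : κ ≤ r * γ ^ 2 * l)
    (u : WithLp 2 (X × Y)) (hu : u.snd ∈ Wp.range) :
    κ / 4 * ‖u.snd‖ ^ 2 - r * LA / 2 * ‖u.fst‖ ^ 2 ≤ r / 2 * ‖mapB A Wp γ u‖ ^ 2 := by
  obtain ⟨y, hy⟩ := hu
  have h1 : ‖γ • Wp u.snd‖ ^ 2 ≤ 2 * ‖A u.fst‖ ^ 2 + 2 * ‖mapB A Wp γ u‖ ^ 2 := by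
    have e : γ • Wp u.snd = mapB A Wp γ u - A u.fst := by
      change _ = (A u.fst + γ • Wp u.snd) - A u.fst; abel
    have := pow_le_pow_left₀ (norm_nonneg _) (norm_sub_le (mapB A Wp γ u) (A u.fst)) 2
    rw [e]
    refine this.trans ?_
    nlinarith [sq_nonneg (‖A u.fst‖ - ‖mapB A Wp γ u‖)]
  rw [norm_smul, mul_pow, Real.norm_eq_abs, sq_abs] at h1
  have h2 := mul_le_mul_of_nonneg_left (hA u.fst) hr.le
  have h3 := mul_le_mul_of_nonneg_left (hW y) (by positivity : 0 ≤ r * γ ^ 2)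
  rw [hy] at h3
  have h4 := mul_le_mul_of_nonneg_right h (sq_nonneg ‖u.snd‖)
  have h5 := mul_le_mul_of_nonneg_left h1 (by positivity : 0 ≤ r / 4)
  linarith

end Stacked

/-! ### Identities between the parameters -/

namespace Params

variable {p : Params}

/-- The smoothness constant of the augmented objective. -/
noncomputable def LG (p : Params) : ℝ := max (p.Lf + p.μf) (8 * p.μf)

theorem Valid.LG_pos (hp : p.Valid) : 0 < p.LG :=
  lt_max_of_lt_right (by linarith [hp.f_pos])

theorem Valid.LG_eq (hp : p.Valid) : p.LG = p.μf * max (1 + p.κf) 8 := by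
  have := hp.f_pos
  rw [LG, mul_max_of_nonneg _ _ this.le, κf]
  congr 1
  · field_simp; ring
  · ring

theorem Valid.one_le_κf (hp : p.Valid) : 1 ≤ p.κf := (one_le_div hp.f_pos).2 hp.f_le

theorem τ_eq : p.τ = 1 / 2 * √(19 / (60 * max (1 + p.κf) 8)) := by
  refine min_eq_right ?_
  have hM : (8 : ℝ) ≤ max (1 + p.κf) 8 := le_max_right _ _
  have : √(19 / (60 * max (1 + p.κf) 8)) ≤ 1 := by
    refine Real.sqrt_le_iff.2 ⟨zero_le_one, ?_⟩
    rw [one_pow, div_le_one (by linarith)]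
    linarith
  linarith

theorem τ_sq : 240 * p.τ ^ 2 * max (1 + p.κf) 8 = 19 := by
  have hM : (8 : ℝ) ≤ max (1 + p.κf) 8 := le_max_right _ _
  rw [τ_eq, mul_pow, Real.sq_sqrt (by positivity)]
  field_simp
  norm_num

theorem τ_pos : 0 < p.τ := by
  have hM : (8 : ℝ) ≤ max (1 + p.κf) 8 := le_max_right _ _
  rw [τ_eq]
  positivity

theorem τ_le_one : p.τ ≤ 1 := min_le_left _ _

theorem Valid.η_pos (hp : p.Valid) : 0 < p.η := by
  have h1 := τ_pos (p := p)
  have h2 := hp.LG_pos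
  have : p.η = 1 / (4 * p.τ * p.LG) := rfl
  rw [this]; positivity

theorem Valid.α_pos (hp : p.Valid) : 0 < p.α := by
  have := hp.f_pos
  unfold α; positivity

theorem Valid.α_le_LG (hp : p.Valid) : p.α ≤ p.LG := by
  have := hp.f_pos
  exact le_max_of_le_right (by unfold α; linarith)

theorem Valid.τ_LG_η (hp : p.Valid) : 4 * p.τ * p.LG * p.η = 1 := by
  have h1 := τ_pos (p := p)
  have h2 := hp.LG_pos
  have : p.η = 1 / (4 * p.τ * p.LG) := rfl
  rw [this]; field_simp

theorem Valid.η_mul_α (hp : p.Valid) : p.η * p.α = 15 / 19 * p.τ := by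
  have h1 := τ_pos (p := p)
  have h2 := hp.LG_pos
  have h3 := hp.LG_eq
  have h4 := τ_sq (p := p)
  have hf := hp.f_pos
  have : p.η = 1 / (4 * p.τ * p.LG) := rfl
  rw [h3] at h2
  rw [this, α, h3]
  have hM : max (1 + p.κf) 8 ≠ 0 := by
    have : (8 : ℝ) ≤ max (1 + p.κf) 8 := le_max_right _ _
    linarith
  field_simp
  linarith

theorem Valid.γ_sq (hp : p.Valid) : p.γ ^ 2 = 225 / 121 * (p.μA + p.LA) := by
  have h1 := hp.A_pos
  have h2 := hp.A_le
  rw [γ, Real.sq_sqrt (div_nonneg (by linarith) (by unfold μW'; norm_num)), μW']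
  ring

theorem Valid.γ_pos (hp : p.Valid) : 0 < p.γ := by
  have h1 := hp.A_pos
  have h2 := hp.A_le
  exact Real.sqrt_pos.2 (div_pos (by linarith) (by unfold μW'; norm_num))

theorem Valid.LA_pos (hp : p.Valid) : 0 < p.LA := hp.A_pos.trans_le hp.A_le

theorem Valid.LB_eq (hp : p.Valid) : p.LB = p.LA + p.γ ^ 2 * (19 / 15) ^ 2 := by
  rw [hp.γ_sq, LB, LW', μW']; ring

theorem Valid.μB_pos (hp : p.Valid) : 0 < p.μB := half_pos hp.A_pos

theorem Valid.μB_le_LB (hp : p.Valid) : p.μB ≤ p.LB := by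
  have h1 := hp.A_pos
  have h2 := hp.A_le
  rw [hp.LB_eq, hp.γ_sq, μB]
  linarith

theorem Valid.r_pos (hp : p.Valid) : 0 < p.r := div_pos hp.f_pos (by linarith [hp.LA_pos])

theorem Valid.r_mul_LA (hp : p.Valid) : p.r * p.LA = p.μf / 2 := by
  have := hp.LA_pos
  rw [r]; field_simp

theorem Valid.κW_eq (hp : p.Valid) : p.κW = √p.LW / √p.μW :=
  Real.sqrt_div' _ hp.W_pos.le

theorem Valid.one_le_κW (hp : p.Valid) : 1 ≤ p.κW :=
  Real.one_le_sqrt.2 ((one_le_div hp.W_pos).2 hp.W_le)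

theorem Valid.one_le_κA (hp : p.Valid) : 1 ≤ p.κA := (one_le_div hp.A_pos).2 hp.A_le

theorem Valid.one_le_κB (hp : p.Valid) : 1 ≤ p.κB := (one_le_div hp.μB_pos).2 hp.μB_le_LB

theorem Valid.one_le_stepsW (hp : p.Valid) : 1 ≤ p.stepsW :=
  Nat.one_le_iff_ne_zero.2 (Nat.ceil_pos.2
    (Real.sqrt_pos.2 (by linarith [hp.one_le_κW]))).ne'

theorem Valid.one_le_stepsB (hp : p.Valid) : 1 ≤ p.stepsB :=
  Nat.one_le_iff_ne_zero.2 (Nat.ceil_pos.2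
    (Real.sqrt_pos.2 (by linarith [hp.one_le_κB]))).ne'

theorem Valid.stepsW_le (hp : p.Valid) : (p.stepsW : ℝ) ≤ 2 * √p.κW := by
  have h := Nat.ceil_lt_add_one (Real.sqrt_nonneg p.κW)
  have : 1 ≤ √p.κW := Real.one_le_sqrt.2 hp.one_le_κW
  unfold stepsW
  linarith

theorem Valid.stepsB_le (hp : p.Valid) : (p.stepsB : ℝ) ≤ 8 * √p.κA := by
  have h := Nat.ceil_lt_add_one (Real.sqrt_nonneg p.κB)
  have h1 : 1 ≤ √p.κB := Real.one_le_sqrt.2 hp.one_le_κB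
  have h2 : √p.κB ≤ 4 * √p.κA := by
    have h16 : √(16 : ℝ) = 4 := by
      rw [show (16 : ℝ) = 4 ^ 2 by norm_num]; exact Real.sqrt_sq (by norm_num)
    rw [← h16, ← Real.sqrt_mul (by norm_num)]
    refine Real.sqrt_le_sqrt ?_
    have hA := hp.A_pos
    have hA' := hp.A_le
    rw [κB, κA, hp.LB_eq, hp.γ_sq, μB, mul_div_assoc', div_le_div_iff₀ (by positivity) hA]
    nlinarith
  unfold stepsB
  linarith

theorem Valid.inv_τ_le (hp : p.Valid) : 1 / p.τ ≤ 11 * √p.κf := by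
  have h1 := τ_pos (p := p)
  have h2 := τ_sq (p := p)
  have h3 := hp.one_le_κf
  have hM : max (1 + p.κf) 8 ≤ 8 * p.κf := max_le (by linarith) (by linarith)
  rw [div_le_iff₀ h1]
  have hs : √p.κf ^ 2 = p.κf := Real.sq_sqrt (by linarith)
  have h4 : 1 ≤ (11 * √p.κf * p.τ) ^ 2 := by
    rw [mul_pow, mul_pow, hs]
    nlinarith [mul_le_mul_of_nonneg_left hM (sq_nonneg p.τ)]
  exact (one_le_sq_iff₀ (by positivity)).1 h4

end Params

/-! ### Linear convergence of the main algorithm -/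

section Convergence

variable {X Y : Type} [NormedAddCommGroup X] [InnerProductSpace ℝ X]
  [NormedAddCommGroup Y] [InnerProductSpace ℝ Y]

/-- The data that the analysis of the main algorithm uses: the oracles compute the linear maps
`A`, `AT` and the gradient of `F`, the procedure `mulW'` computes a well-conditioned `Wp`, and `us`
is the solution of the lifted problem `min F(x)` subject to `A x + γ W' y = b`. -/
structure LiftedProblem (p : Params) (O : Oracles X Y) (b : Y) (A : X →ₗ[ℝ] Y) (AT : Y →ₗ[ℝ] X)
    (Wp : Y →ₗ[ℝ] Y) (F : X → ℝ) (us : WithLp 2 (X × Y)) : Prop where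
  valid : p.Valid
  oracle_A : O.A = A
  oracle_AT : O.AT = AT
  value_mulW' : ∀ y, (mulW' p y : Prog X Y Y).value O = Wp y
  adjoint : ∀ x y, inner ℝ (A x) y = inner ℝ x (AT y)
  norm_A : ∀ x, ‖A x‖ ^ 2 ≤ p.LA * ‖x‖ ^ 2
  wellConditioned : WellConditioned (11 / 15) (19 / 15) Wp
  lower : ∀ y, (∀ w, mapBT AT Wp p.γ w = 0 → inner ℝ y w = 0) →
    p.μB * ‖y‖ ^ 2 ≤ ‖mapBT AT Wp p.γ y‖ ^ 2
  F_lower : ∀ u v, p.μf / 2 * ‖v - u‖ ^ 2 ≤ F v - F u - inner ℝ (O.grad u) (v - u)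
  F_upper : ∀ u v, F v - F u - inner ℝ (O.grad u) (v - u) ≤ p.Lf / 2 * ‖v - u‖ ^ 2
  us_mem : us.snd ∈ Wp.range
  us_feasible : mapB A Wp p.γ us = b
  us_optimal : ∀ v, mapB A Wp p.γ v = 0 → inner ℝ (O.grad us.fst) v.fst = 0

namespace LiftedProblem

variable {p : Params} {O : Oracles X Y} {b : Y} {A : X →ₗ[ℝ] Y} {AT : Y →ₗ[ℝ] X}
  {Wp : Y →ₗ[ℝ] Y} {F : X → ℝ} {us : WithLp 2 (X × Y)}

/-- The preconditioned operator `K` that `kChebyshev` applies to the error. -/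
noncomputable def opK (p : Params) (A : X →ₗ[ℝ] Y) (AT : Y →ₗ[ℝ] X) (Wp : Y →ₗ[ℝ] Y) :
    WithLp 2 (X × Y) →ₗ[ℝ] WithLp 2 (X × Y) :=
  Polynomial.aeval (mapBT AT Wp p.γ ∘ₗ mapB A Wp p.γ) (chebPhi p.LB p.μB p.stepsB)

variable (h : LiftedProblem p O b A AT Wp F us)

include h

theorem eigenIn : EigenIn p.μB p.LB (mapBT AT Wp p.γ ∘ₗ mapB A Wp p.γ) := by
  refine eigenIn_normal h.adjoint h.wellConditioned.symm (fun u => ?_) h.lower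
  rw [h.valid.LB_eq]
  exact norm_mapB_sq_le h.valid.LA_pos h.valid.γ_pos (by norm_num) h.norm_A
    h.wellConditioned.norm_le u

theorem bregman_convex (v w : WithLp 2 (X × Y)) :
    bregman F O.grad p.r (mapB A Wp p.γ) us w
      + inner ℝ (bregmanGrad O.grad p.r (mapB A Wp p.γ) (mapBT AT Wp p.γ) us w) (v - w)
      ≤ bregman F O.grad p.r (mapB A Wp p.γ) us v := by
  rw [bregman_eq (F := F) (inner_mapB (γ := p.γ) h.adjoint h.wellConditioned.symm) us v w]
  have h1 := h.F_lower w.fst v.fst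
  have h2 := h.valid.r_pos
  have h3 : 0 ≤ p.μf / 2 * ‖v.fst - w.fst‖ ^ 2 := by have := h.valid.f_pos; positivity
  have h4 : 0 ≤ p.r / 2 * ‖mapB A Wp p.γ (v - w)‖ ^ 2 := by positivity
  linarith

theorem bregman_nonneg (v : WithLp 2 (X × Y)) :
    0 ≤ bregman F O.grad p.r (mapB A Wp p.γ) us v := by
  have h1 := h.F_lower us.fst v.fst
  have h2 := h.valid.r_pos
  have h3 : 0 ≤ p.μf / 2 * ‖v.fst - us.fst‖ ^ 2 := by have := h.valid.f_pos; positivity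
  have h4 : 0 ≤ p.r / 2 * ‖mapB A Wp p.γ (v - us)‖ ^ 2 := by positivity
  unfold bregman
  linarith

theorem bregman_smooth (v w : WithLp 2 (X × Y)) :
    bregman F O.grad p.r (mapB A Wp p.γ) us v
      ≤ bregman F O.grad p.r (mapB A Wp p.γ) us w
        + inner ℝ (bregmanGrad O.grad p.r (mapB A Wp p.γ) (mapBT AT Wp p.γ) us w) (v - w)
        + p.LG / 2 * ‖v - w‖ ^ 2 := by
  rw [bregman_eq (F := F) (inner_mapB (γ := p.γ) h.adjoint h.wellConditioned.symm) us v w]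
  have h1 := h.F_upper w.fst v.fst
  have hA := h.valid.A_le
  have hf := h.valid.f_pos
  have hr := h.valid.r_pos
  have hrA := h.valid.r_mul_LA
  have h2 := augmented_smooth (κ := 4 * p.μf) hr h.norm_A h.wellConditioned.norm_le (by
    rw [h.valid.γ_sq]
    nlinarith [mul_le_mul_of_nonneg_left hA hr.le]) (v - w)
  rw [hrA] at h2
  have h3 : p.Lf + p.μf ≤ p.LG := le_max_left _ _
  have h4 : 8 * p.μf ≤ p.LG := le_max_right _ _
  rw [WithLp.prod_norm_sq_eq_of_L2, WithLp.sub_fst, WithLp.sub_snd]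
  rw [WithLp.sub_fst, WithLp.sub_snd] at h2
  nlinarith [mul_le_mul_of_nonneg_right h3 (sq_nonneg ‖v.fst - w.fst‖),
    mul_le_mul_of_nonneg_right h4 (sq_nonneg ‖v.snd - w.snd‖)]

theorem bregman_strong {w : WithLp 2 (X × Y)} (hw : w.snd ∈ Wp.range) :
    bregman F O.grad p.r (mapB A Wp p.γ) us w
      + inner ℝ (bregmanGrad O.grad p.r (mapB A Wp p.γ) (mapBT AT Wp p.γ) us w) (us - w)
      + p.α / 2 * ‖us - w‖ ^ 2 ≤ 0 := by
  have h0 := bregman_eq (F := F) (dF := O.grad) (r := p.r)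
    (inner_mapB (γ := p.γ) h.adjoint h.wellConditioned.symm) us us w
  rw [bregman_self] at h0
  have h1 := h.F_lower w.fst us.fst
  have hf := h.valid.f_pos
  have hA := h.valid.A_pos
  have hr := h.valid.r_pos
  have hrA := h.valid.r_mul_LA
  have h2 := augmented_strong (κ := p.μf / 2) hr h.norm_A h.wellConditioned.norm_ge (by
    rw [h.valid.γ_sq]
    nlinarith [mul_pos hr hA]) (us - w) (by
      rw [WithLp.sub_snd]; exact Submodule.sub_mem _ h.us_mem hw)
  rw [hrA, WithLp.sub_fst, WithLp.sub_snd] at h2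
  rw [WithLp.prod_norm_sq_eq_of_L2, WithLp.sub_fst, WithLp.sub_snd, Params.α]
  nlinarith [mul_nonneg hf.le (sq_nonneg ‖us.fst - w.fst‖)]

theorem value_gradG_eq (u : X × Y) : WithLp.toLp 2 ((gradG p b u).value O)
    = bregmanGrad O.grad p.r (mapB A Wp p.γ) (mapBT AT Wp p.γ) us (WithLp.toLp 2 u)
      + WithLp.toLp 2 (O.grad us.fst, 0) := by
  have hB : mapB A Wp p.γ (WithLp.toLp 2 u - us) = A u.1 + p.γ • Wp u.2 - b := by
    rw [map_sub, h.us_feasible]; rfl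
  rw [value_gradG b h.value_mulW', h.oracle_A, h.oracle_AT, bregmanGrad, hB, ← map_smul]
  refine WithLp.ofLp_injective 2 (Prod.ext ?_ ?_)
  · simp [mapBT]
    abel
  · simp [mapBT, smul_comm p.γ p.r]

theorem value_kChebyshev_eq (u : X × Y) : WithLp.toLp 2 ((kChebyshev p b u).value O)
    = opK p A AT Wp (WithLp.toLp 2 u - us) := by
  rw [value_kChebyshev b h.value_mulW']
  refine sub_chebLoop_eq h.valid.μB_pos h.valid.μB_le_LB _
    (WithLp.linearEquiv 2 ℝ (X × Y)).symm.toLinearMap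
    (mapBT AT Wp p.γ ∘ₗ mapB A Wp p.γ) us (fun v => ?_) h.valid.one_le_stepsB u
  have hB : mapB A Wp p.γ (WithLp.toLp 2 v - us) = A v.1 + p.γ • Wp v.2 - b := by
    rw [map_sub, h.us_feasible]; rfl
  change WithLp.toLp 2 (normalOp O p b Wp v)
    = mapBT AT Wp p.γ (mapB A Wp p.γ (WithLp.toLp 2 v - us))
  rw [hB, normalOp, h.oracle_A, h.oracle_AT]
  rfl

theorem opK_snd_mem (v : WithLp 2 (X × Y)) : (opK p A AT Wp v).snd ∈ Wp.range := by
  obtain ⟨q, hq⟩ := exists_aeval_normal_eq (A := A) (AT := AT) (Wp := Wp) (γ := p.γ)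
    (chebPhi_eval_zero h.valid.μB_pos h.valid.μB_le_LB p.stepsB) v
  rw [opK, hq]
  exact Submodule.smul_mem _ _ ⟨q, rfl⟩

variable [FiniteDimensional ℝ X] [FiniteDimensional ℝ Y]

theorem wellConditioned_opK : WellConditioned (11 / 15) (19 / 15) (opK p A AT Wp) :=
  wellConditioned_aeval (isSymmetric_normal h.adjoint h.wellConditioned.symm) h.eigenIn
    (by norm_num) (chebPhi_eval_zero h.valid.μB_pos h.valid.μB_le_LB _)
    fun _ h₁ h₂ => chebPhi_eval_mem h.valid.μB_pos h.valid.μB_le_LB (Nat.le_ceil _) h₁ h₂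

/-- The optimal multiplier `-∇F(x*)` lies in the range of `K`, since the optimality condition makes
it orthogonal to the kernel of `B`. -/
theorem exists_dual : ∃ ζ, opK p A AT Wp ζ = WithLp.toLp 2 (O.grad us.fst, 0) := by
  have hs := isSymmetric_normal (γ := p.γ) h.adjoint h.wellConditioned.symm
  refine exists_apply_eq_of_orthogonal_ker h.wellConditioned_opK.symm fun v hv => ?_
  have h1 := apply_eq_zero_of_aeval_eq_zero hs h.eigenIn h.valid.μB_pos
    (by norm_num : (0 : ℝ) < 11 / 15) (chebPhi_eval_zero h.valid.μB_pos h.valid.μB_le_LB _)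
    (fun _ h₁ h₂ =>
      (chebPhi_eval_mem h.valid.μB_pos h.valid.μB_le_LB (Nat.le_ceil _) h₁ h₂).1) hv
  have h2 : mapB A Wp p.γ v = 0 := by
    have : ‖mapB A Wp p.γ v‖ ^ 2 = 0 := by
      rw [← real_inner_self_eq_norm_sq, inner_mapB h.adjoint h.wellConditioned.symm]
      rw [LinearMap.comp_apply] at h1
      rw [h1, inner_zero_right]
    simpa using this
  have h3 := h.us_optimal v h2
  rw [WithLp.prod_inner_apply]
  simpa using h3

/-- One iteration keeps the second components in the range of `W'` and the dual error in the range
of `K`, and contracts the potential. -/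
theorem step_contracts (s : State X Y) (ζ : WithLp 2 (X × Y))
    (hz : WithLp.toLp 2 s.z = opK p A AT Wp ζ - WithLp.toLp 2 (O.grad us.fst, 0))
    (hu : s.u.2 ∈ Wp.range) (huf : s.uf.2 ∈ Wp.range) (hs : s.z.2 ∈ Wp.range) :
    ∃ ζ', WithLp.toLp 2 ((step p b s).value O).z
        = opK p A AT Wp ζ' - WithLp.toLp 2 (O.grad us.fst, 0) ∧
      ((step p b s).value O).u.2 ∈ Wp.range ∧ ((step p b s).value O).uf.2 ∈ Wp.range ∧
      ((step p b s).value O).z.2 ∈ Wp.range ∧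
      (1 + p.τ / 12) * potential p.τ p.η p.α (opK p A AT Wp)
          (WithLp.toLp 2 ((step p b s).value O).u - us) ζ'
          (bregman F O.grad p.r (mapB A Wp p.γ) us (WithLp.toLp 2 ((step p b s).value O).uf))
        ≤ potential p.τ p.η p.α (opK p A AT Wp) (WithLp.toLp 2 s.u - us) ζ
          (bregman F O.grad p.r (mapB A Wp p.γ) us (WithLp.toLp 2 s.uf)) := by
  set ug := p.τ • s.u + (1 - p.τ) • s.uf with hug
  set g := (gradG p b ug).value O - p.α • ug with hg
  set uh := (1 + p.η * p.α)⁻¹ • (s.u - p.η • (g + s.z)) with huh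
  set z' := s.z + p.θ • (kChebyshev p b uh).value O with hz'
  set u' := (1 + p.η * p.α)⁻¹ • (s.u - p.η • (g + z')) with hu'
  set uf' := ug + (2 * p.τ / (2 - p.τ)) • (u' - s.u) with huf'
  have hval : (step p b s).value O = ⟨u', uf', z'⟩ := by
    simp only [step, Prog.value_bind, Prog.value_pure]
    rfl
  rw [hval]
  have hK := h.value_kChebyshev_eq uh
  have hG := h.value_gradG_eq ug
  have hGs : ((gradG p b ug).value O).2 ∈ Wp.range := by
    rw [value_gradG b h.value_mulW']
    exact Submodule.smul_mem _ _ ⟨_, rfl⟩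
  have hKs : ((kChebyshev p b uh).value O).2 ∈ Wp.range := by
    have := h.opK_snd_mem (WithLp.toLp 2 uh - us)
    rw [← hK] at this
    exact this
  have hugs : ug.2 ∈ Wp.range :=
    Submodule.add_mem _ (Submodule.smul_mem _ _ hu) (Submodule.smul_mem _ _ huf)
  have hgs : g.2 ∈ Wp.range := Submodule.sub_mem _ hGs (Submodule.smul_mem _ _ hugs)
  have hzs : z'.2 ∈ Wp.range := Submodule.add_mem _ hs (Submodule.smul_mem _ _ hKs)
  have hus : u'.2 ∈ Wp.range := Submodule.smul_mem _ _
    (Submodule.sub_mem _ hu (Submodule.smul_mem _ _ (Submodule.add_mem _ hgs hzs)))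
  have hufs : uf'.2 ∈ Wp.range :=
    Submodule.add_mem _ hugs (Submodule.smul_mem _ _ (Submodule.sub_mem _ hus hu))
  set ζ' := ζ + p.θ • (WithLp.toLp 2 uh - us) with hζ'
  have hzK : WithLp.toLp 2 z' = opK p A AT Wp ζ' - WithLp.toLp 2 (O.grad us.fst, 0) := by
    rw [hz', hζ', WithLp.toLp_add, WithLp.toLp_smul, hK, hz, map_add, map_smul]
    abel
  refine ⟨ζ', hzK, hus, hufs, hzs, ?_⟩
  have hgz : ∀ (z ξ : _), WithLp.toLp 2 z
      = opK p A AT Wp ξ - WithLp.toLp 2 (O.grad us.fst, 0) →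
      WithLp.toLp 2 (g + z) = bregmanGrad O.grad p.r (mapB A Wp p.γ) (mapBT AT Wp p.γ) us
        (WithLp.toLp 2 ug) - p.α • WithLp.toLp 2 ug + opK p A AT Wp ξ := by
    intro z ξ hzξ
    rw [hg, WithLp.toLp_add, WithLp.toLp_sub, WithLp.toLp_smul, hG, hzξ]
    abel
  refine potential_step (L := p.LG) (uh := WithLp.toLp 2 uh) (ug := WithLp.toLp 2 ug)
    Params.τ_pos Params.τ_le_one h.valid.η_pos h.valid.α_pos h.valid.α_le_LG h.valid.τ_LG_η
    h.valid.η_mul_α h.wellConditioned_opK h.bregman_nonneg h.bregman_convex h.bregman_smooth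
    (h.bregman_strong hugs) ?_ ?_ ?_ ?_ ?_
  · rw [hug, WithLp.toLp_add, WithLp.toLp_smul, WithLp.toLp_smul]
  · rw [huh, WithLp.toLp_smul, WithLp.toLp_sub, WithLp.toLp_smul, hgz s.z ζ hz]
  · rw [hζ']; rfl
  · rw [hu', WithLp.toLp_smul, WithLp.toLp_sub, WithLp.toLp_smul, hgz z' ζ' hzK]
  · rw [huf', WithLp.toLp_add, WithLp.toLp_smul, WithLp.toLp_sub]

/-- Linear convergence of the iterates. -/
theorem exists_linear_rate (x₀ : X) : ∃ D : ℝ, 0 < D ∧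
    ∀ k, (1 + p.τ / 12) ^ k * ‖((mainAlg p b x₀ k).value O).u.1 - us.fst‖ ^ 2 ≤ D := by
  obtain ⟨ζ₀, hζ₀⟩ := h.exists_dual
  set Φ₀ := potential p.τ p.η p.α (opK p A AT Wp) (WithLp.toLp 2 (x₀, 0) - us) ζ₀
    (bregman F O.grad p.r (mapB A Wp p.γ) us (WithLp.toLp 2 (x₀, 0)))
  have inv : ∀ k, ∃ ζ, WithLp.toLp 2 ((mainAlg p b x₀ k).value O).z
        = opK p A AT Wp ζ - WithLp.toLp 2 (O.grad us.fst, 0) ∧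
      ((mainAlg p b x₀ k).value O).u.2 ∈ Wp.range ∧
      ((mainAlg p b x₀ k).value O).uf.2 ∈ Wp.range ∧
      ((mainAlg p b x₀ k).value O).z.2 ∈ Wp.range ∧
      (1 + p.τ / 12) ^ k * potential p.τ p.η p.α (opK p A AT Wp)
          (WithLp.toLp 2 ((mainAlg p b x₀ k).value O).u - us) ζ
          (bregman F O.grad p.r (mapB A Wp p.γ) us
            (WithLp.toLp 2 ((mainAlg p b x₀ k).value O).uf)) ≤ Φ₀ := by
    intro k
    induction k with
    | zero =>
      refine ⟨ζ₀, ?_, ?_, ?_, ?_, ?_⟩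
      · rw [hζ₀, sub_self]; simp [mainAlg]
      all_goals simp [mainAlg, Φ₀]
    | succ k ih =>
      obtain ⟨ζ, h1, h2, h3, h4, h5⟩ := ih
      obtain ⟨ζ', h1', h2', h3', h4', h5'⟩ := h.step_contracts _ ζ h1 h2 h3 h4
      have hval : (mainAlg p b x₀ (k + 1)).value O
          = (step p b ((mainAlg p b x₀ k).value O)).value O := by simp [mainAlg]
      rw [hval]
      refine ⟨ζ', h1', h2', h3', h4', ?_⟩
      have hpos : 0 ≤ (1 + p.τ / 12) ^ k := pow_nonneg (by linarith [Params.τ_pos (p := p)]) k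
      rw [pow_succ, mul_assoc]
      exact (mul_le_mul_of_nonneg_left h5' hpos).trans h5
  have hη := h.valid.η_pos
  refine ⟨p.η * |Φ₀| + 1, by positivity, fun k => ?_⟩
  obtain ⟨ζ, -, -, -, -, h5⟩ := inv k
  have h6 := le_potential (Params.τ_pos (p := p)) Params.τ_le_one hη h.valid.α_pos h.wellConditioned_opK
    (WithLp.toLp 2 ((mainAlg p b x₀ k).value O).u - us) ζ (h.bregman_nonneg
      (WithLp.toLp 2 ((mainAlg p b x₀ k).value O).uf))
  have hpos : 0 ≤ (1 + p.τ / 12) ^ k := pow_nonneg (by linarith [Params.τ_pos (p := p)]) k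
  have h7 := (mul_le_mul_of_nonneg_left h6 hpos).trans h5
  have h8 : ‖((mainAlg p b x₀ k).value O).u.1 - us.fst‖ ^ 2
      ≤ ‖WithLp.toLp 2 ((mainAlg p b x₀ k).value O).u - us‖ ^ 2 := by
    rw [WithLp.prod_norm_sq_eq_of_L2]
    exact le_add_of_nonneg_right (sq_nonneg _)
  have h9 := mul_le_mul_of_nonneg_left h8 hpos
  have h10 : (1 + p.τ / 12) ^ k * ‖WithLp.toLp 2 ((mainAlg p b x₀ k).value O).u - us‖ ^ 2
      ≤ p.η * Φ₀ := by
    have := mul_le_mul_of_nonneg_left h7 hη.le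
    refine le_trans (le_of_eq ?_) this
    field_simp
  have h11 := mul_le_mul_of_nonneg_left (le_abs_self Φ₀) hη.le
  linarith

end LiftedProblem

end Convergence

/-! ### The constrained minimization problem -/

section Minimization

variable {E Z : Type*} [NormedAddCommGroup E] [InnerProductSpace ℝ E]
  [NormedAddCommGroup Z] [InnerProductSpace ℝ Z]

/-- At a minimizer over an affine subspace the gradient is orthogonal to the directions of the
subspace; the quadratic upper bound replaces differentiability. -/
theorem inner_grad_eq_zero {L : ℝ} {F : E → ℝ} {dF : E → E}
    (hup : ∀ u v, F v - F u - inner ℝ (dF u) (v - u) ≤ L / 2 * ‖v - u‖ ^ 2) {T : E →ₗ[ℝ] Z}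
    {x v : E} (hmin : ∀ y, T y = T x → F x ≤ F y) (hv : T v = 0) : inner ℝ (dF x) v = 0 := by
  have h : ∀ t : ℝ, 0 ≤ L / 2 * ‖v‖ ^ 2 * (t * t) + inner ℝ (dF x) v * t + 0 := by
    intro t
    have h1 := hmin (x + t • v) (by rw [map_add, map_smul, hv, smul_zero, add_zero])
    have h2 := hup x (x + t • v)
    rw [add_sub_cancel_left, inner_smul_right, norm_smul, mul_pow, Real.norm_eq_abs, sq_abs] at h2
    linarith
  have hd := discrim_le_zero h
  rw [discrim] at hd
  have : inner ℝ (dF x) v ^ 2 ≤ 0 := by linarith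
  simpa using le_antisymm this (sq_nonneg _)

theorem exists_constrained_min [FiniteDimensional ℝ E] {μ : ℝ} (hμ : 0 < μ) {F : E → ℝ}
    {dF : E → E} (hF : Continuous F)
    (hlow : ∀ u v, μ / 2 * ‖v - u‖ ^ 2 ≤ F v - F u - inner ℝ (dF u) (v - u)) (T : E →ₗ[ℝ] Z)
    (x₀ : E) : ∃ x, T x = T x₀ ∧ ∀ y, T y = T x₀ → F x ≤ F y := by
  have hclosed : IsClosed {x | T x = T x₀} :=
    isClosed_eq T.continuous_of_finiteDimensional continuous_const
  obtain ⟨x, hx, hmin⟩ := hF.continuousOn.exists_isMinOn' hclosed (x₀ := x₀) rfl (by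
    have := (isCompact_closedBall x₀ (2 / μ * ‖dF x₀‖)).compl_mem_cocompact
    filter_upwards [Filter.mem_inf_of_left this] with x hx
    rw [Set.mem_compl_iff, Metric.mem_closedBall, dist_eq_norm, not_le] at hx
    have h1 := hlow x₀ x
    have h2 := neg_le_of_abs_le (abs_real_inner_le_norm (dF x₀) (x - x₀))
    have h3 : ‖dF x₀‖ ≤ μ / 2 * ‖x - x₀‖ := by
      have := mul_le_mul_of_nonneg_left hx.le (half_pos hμ).le
      refine le_trans (le_of_eq ?_) this
      field_simp
    nlinarith [norm_nonneg (x - x₀), mul_le_mul_of_nonneg_right h3 (norm_nonneg (x - x₀))])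
  exact ⟨x, hx, fun y hy => hmin hy⟩

end Minimization

section Problem

variable {n m : ℕ} {d : Fin n → ℕ}

theorem feasible_iff (A : ∀ i, Matrix (Fin m) (Fin (d i)) ℝ) (b : Blocks n m) (x : Primal n d) :
    Feasible A b x ↔ sumBlocks n m (linA A x) = sumBlocks n m b := by
  have : (sumBlocks n m (linA A x - b)).ofLp = ∑ i, (A i *ᵥ (x i).ofLp - (b i).ofLp) := by
    simp [sumBlocks, linA, applyA]
  rw [Feasible, ← this, WithLp.ofLp_eq_zero, map_sub, sub_eq_zero]

/-- The separable objective. -/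
noncomputable def objF (f : ∀ i, EuclideanSpace ℝ (Fin (d i)) → ℝ) (x : Primal n d) : ℝ :=
  ∑ i, f i (x i)

theorem objF_lower {L μ : ℝ} {f : ∀ i, EuclideanSpace ℝ (Fin (d i)) → ℝ}
    (hf : ∀ i, SmoothStronglyConvex L μ (f i)) (u v : Primal n d) :
    μ / 2 * ‖v - u‖ ^ 2 ≤ objF f v - objF f u - inner ℝ (gradF f u) (v - u) := by
  rw [objF, objF, PiLp.inner_apply, PiLp.norm_sq_eq_of_L2, Finset.mul_sum,
    ← Finset.sum_sub_distrib, ← Finset.sum_sub_distrib]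
  exact Finset.sum_le_sum fun i _ => (hf i).lower (u i) (v i)

theorem objF_upper {L μ : ℝ} {f : ∀ i, EuclideanSpace ℝ (Fin (d i)) → ℝ}
    (hf : ∀ i, SmoothStronglyConvex L μ (f i)) (u v : Primal n d) :
    objF f v - objF f u - inner ℝ (gradF f u) (v - u) ≤ L / 2 * ‖v - u‖ ^ 2 := by
  rw [objF, objF, PiLp.inner_apply, PiLp.norm_sq_eq_of_L2, Finset.mul_sum,
    ← Finset.sum_sub_distrib, ← Finset.sum_sub_distrib]
  exact Finset.sum_le_sum fun i _ => (hf i).upper (u i) (v i)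

theorem continuous_objF {L μ : ℝ} {f : ∀ i, EuclideanSpace ℝ (Fin (d i)) → ℝ}
    (hf : ∀ i, SmoothStronglyConvex L μ (f i)) : Continuous (objF f) :=
  continuous_finsetSum _ fun i _ => (hf i).contDiff.continuous.comp (by fun_prop)

/-! ### The preconditioned gossip operator -/

/-- The operator `W'` computed by `mulW'`. -/
noncomputable def opW (p : Params) (m : ℕ) (W : Matrix (Fin n) (Fin n) ℝ) :
    Blocks n m →ₗ[ℝ] Blocks n m :=
  Polynomial.aeval (linW W) (chebPhi √p.LW √p.μW p.stepsW)

variable {G : SimpleGraph (Fin n)} {W : Matrix (Fin n) (Fin n) ℝ} {p : Params}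

theorem value_mulW'_eq_opW {X : Type} (hp : p.Valid)
    (O : Oracles X (Blocks n m)) (hO : O.W = applyW W) (y : Blocks n m) :
    (mulW' p y : Prog X (Blocks n m) (Blocks n m)).value O = opW p m W y := by
  rw [value_mulW'_eq, hO]
  have h := sub_chebLoop_eq (Real.sqrt_pos.2 hp.W_pos) (Real.sqrt_le_sqrt hp.W_le) (applyW W)
    LinearMap.id (linW W) (0 : Blocks n m) (fun u => by simp [linW]) hp.one_le_stepsW y
  rw [LinearMap.id_apply, LinearMap.id_apply, sub_zero] at h
  exact h

theorem chebPhi_W_mem (hp : p.Valid) {t : ℝ} (h₁ : √p.μW ≤ t) (h₂ : t ≤ √p.LW) :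
    11 / 15 ≤ (chebPhi √p.LW √p.μW p.stepsW).eval t ∧
      (chebPhi √p.LW √p.μW p.stepsW).eval t ≤ 19 / 15 :=
  chebPhi_eval_mem (Real.sqrt_pos.2 hp.W_pos) (Real.sqrt_le_sqrt hp.W_le)
    (by rw [← hp.κW_eq]; exact Nat.le_ceil _) h₁ h₂

theorem isSymmetric_linW_of_isGossip {L μ : ℝ} (hW : IsGossip G L μ W) :
    (linW (m := m) W).IsSymmetric :=
  isSymmetric_linW hW.posSemidef.isHermitian

theorem wellConditioned_opW (hp : p.Valid) (hW : IsGossip G p.LW p.μW W) :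
    WellConditioned (11 / 15) (19 / 15) (opW p m W) :=
  wellConditioned_aeval (isSymmetric_linW_of_isGossip hW) (eigenIn_linW hW) (by norm_num)
    (chebPhi_eval_zero (Real.sqrt_pos.2 hp.W_pos) (Real.sqrt_le_sqrt hp.W_le) _)
    fun _ h₁ h₂ => chebPhi_W_mem hp h₁ h₂

theorem opW_eq_zero_iff (hp : p.Valid) (hW : IsGossip G p.LW p.μW W) (y : Blocks n m) :
    opW p m W y = 0 ↔ ∃ c, y = consensus n c := by
  have h0 := chebPhi_eval_zero (Real.sqrt_pos.2 hp.W_pos) (Real.sqrt_le_sqrt hp.W_le) p.stepsW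
  rw [← linW_eq_zero_iff hW.kernel]
  constructor
  · exact fun h => apply_eq_zero_of_aeval_eq_zero (isSymmetric_linW_of_isGossip hW)
      (eigenIn_linW hW) (Real.sqrt_pos.2 hp.W_pos) (by norm_num : (0 : ℝ) < 11 / 15) h0
      (fun _ h₁ h₂ => (chebPhi_W_mem hp h₁ h₂).1) h
  · intro h
    obtain ⟨ψ, hψ⟩ : Polynomial.X ∣ chebPhi √p.LW √p.μW p.stepsW := by
      rw [Polynomial.X_dvd_iff, Polynomial.coeff_zero_eq_eval_zero, h0]
    rw [opW, hψ, mul_comm, map_mul, Polynomial.aeval_X, Module.End.mul_apply, h, map_zero]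

/-- A vector whose blocks sum to zero is `W'` applied to a vector in the range of `W'`. -/
theorem exists_opW_opW_eq (hp : p.Valid) (hW : IsGossip G p.LW p.μW W) {v : Blocks n m}
    (hv : sumBlocks n m v = 0) : ∃ q, opW p m W (opW p m W q) = v := by
  have hK := wellConditioned_opW (m := m) hp hW
  refine exists_apply_eq_of_orthogonal_ker (M := opW p m W ∘ₗ opW p m W) (fun x y => ?_)
    fun w hw => ?_
  · rw [LinearMap.comp_apply, LinearMap.comp_apply, hK.symm, hK.symm]
  · have h1 := hK.norm_ge w
    rw [LinearMap.comp_apply] at hw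
    rw [hw, norm_zero] at h1
    have h2 : opW p m W w = 0 := by
      have : ‖opW p m W w‖ ^ 2 ≤ 0 := by nlinarith
      simpa using le_antisymm this (sq_nonneg _)
    obtain ⟨c, rfl⟩ := (opW_eq_zero_iff hp hW w).1 h2
    rw [inner_consensus, hv, inner_zero_left]

theorem norm_linAT_sq_le {L : ℝ} (hL : 0 ≤ L) {A : ∀ i, Matrix (Fin m) (Fin (d i)) ℝ}
    (hA : ∀ x, ‖linA A x‖ ^ 2 ≤ L * ‖x‖ ^ 2) (q : Blocks n m) :
    ‖linAT A q‖ ^ 2 ≤ L * ‖q‖ ^ 2 := by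
  have h1 : ‖linAT A q‖ ^ 2 = inner ℝ (linA A (linAT A q)) q := by
    rw [inner_linA, real_inner_self_eq_norm_sq]
  have h2 := real_inner_le_norm (linA A (linAT A q)) q
  have h3 := hA (linAT A q)
  have h4 : ‖linAT A q‖ ^ 2 ≤ ‖linA A (linAT A q)‖ * ‖q‖ := h1 ▸ h2
  have h5 := pow_le_pow_left₀ (sq_nonneg _) h4 2
  rw [mul_pow] at h5
  have h6 : ‖linAT A q‖ ^ 2 * ‖linAT A q‖ ^ 2 ≤ L * ‖q‖ ^ 2 * ‖linAT A q‖ ^ 2 := by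
    nlinarith [mul_le_mul_of_nonneg_right h3 (sq_nonneg ‖q‖)]
  rcases (sq_nonneg ‖linAT A q‖).eq_or_lt with h0 | h0
  · rw [← h0]; positivity
  · exact le_of_mul_le_mul_right h6 h0

/-- The lower bound `μ_B` for `Bᵀ` on the orthogonal complement of its kernel. Such a vector is
split into its consensus part, on which `Aᵀ` is bounded below because of `S`, and the rest, on which
`γ W'` is bounded below and dominates the cross terms of `Aᵀ`. -/
theorem mapBT_lower (hp : p.Valid) (hW : IsGossip G p.LW p.μW W)
    {A : ∀ i, Matrix (Fin m) (Fin (d i)) ℝ} {b : Blocks n m}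
    (hA : ConstraintBounds p.LA p.μA A b) (y : Blocks n m)
    (hy : ∀ w, mapBT (linAT A) (opW p m W) p.γ w = 0 → inner ℝ y w = 0) :
    p.μB * ‖y‖ ^ 2 ≤ ‖mapBT (linAT A) (opW p m W) p.γ y‖ ^ 2 := by
  rcases Nat.eq_zero_or_pos n with rfl | hn
  · have h0 : ‖y‖ ^ 2 = 0 := by simp [PiLp.norm_sq_eq_of_L2]
    rw [h0, mul_zero]
    positivity
  have hn' : (n : ℝ) ≠ 0 := by exact_mod_cast hn.ne'
  have hK := wellConditioned_opW (m := m) hp hW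
  set c := (1 / (n : ℝ)) • sumBlocks n m y with hc
  set yc := consensus n c with hyc
  obtain ⟨yo, hyo⟩ : ∃ yo, yo = y - yc := ⟨_, rfl⟩
  have hsum : sumBlocks n m yo = 0 := by
    have : sumBlocks n m yc = (n : ℝ) • c := by
      simp [sumBlocks, hyc, consensus, Nat.cast_smul_eq_nsmul]
    rw [hyo, map_sub, this, hc, smul_smul, mul_one_div_cancel hn', one_smul, sub_self]
  have hyeq : y = yc + yo := by rw [hyo]; abel
  have horth : inner ℝ yc yo = 0 := by
    rw [real_inner_comm, hyc, inner_consensus, hsum, inner_zero_left]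
  have hnorm : ‖y‖ ^ 2 = ‖yc‖ ^ 2 + ‖yo‖ ^ 2 := by
    rw [hyeq, norm_add_sq_real, horth]; ring
  have hker : ∀ v, opW p m W (consensus n v) = 0 := fun v =>
    (opW_eq_zero_iff hp hW _).2 ⟨v, rfl⟩
  have hWy : opW p m W y = opW p m W yo := by rw [hyeq, map_add, hker, zero_add]
  have hWlow : (11 / 15 : ℝ) ^ 2 * ‖yo‖ ^ 2 ≤ ‖opW p m W yo‖ ^ 2 := by
    obtain ⟨q, hq⟩ := exists_opW_opW_eq hp hW hsum
    rw [← hq]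
    exact hK.norm_ge _
  have hAc : p.μA * ‖yc‖ ^ 2 ≤ ‖linAT A yc‖ ^ 2 := by
    refine norm_linAT_consensus_sq_ge hA.lower c fun v hv => ?_
    have h1 := hy (consensus n v) (by
      change WithLp.toLp 2 (linAT A (consensus n v), p.γ • opW p m W (consensus n v)) = 0
      rw [hv, hker, smul_zero]
      rfl)
    rw [inner_consensus] at h1
    rw [hc, inner_smul_left, h1, mul_zero]
  have hAo := norm_linAT_sq_le hp.LA_pos.le (norm_linA_sq_le hA.upper) yo
  have htri : ‖linAT A yc‖ ^ 2 ≤ 2 * ‖linAT A y‖ ^ 2 + 2 * ‖linAT A yo‖ ^ 2 := by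
    have e : linAT A yc = linAT A y - linAT A yo := by rw [hyeq, map_add]; abel
    have := pow_le_pow_left₀ (norm_nonneg _) (norm_sub_le (linAT A y) (linAT A yo)) 2
    rw [e]
    refine this.trans ?_
    nlinarith [sq_nonneg (‖linAT A y‖ - ‖linAT A yo‖)]
  have hBT : ‖mapBT (linAT A) (opW p m W) p.γ y‖ ^ 2
      = ‖linAT A y‖ ^ 2 + p.γ ^ 2 * ‖opW p m W yo‖ ^ 2 := by
    rw [WithLp.prod_norm_sq_eq_of_L2]
    change ‖linAT A y‖ ^ 2 + ‖p.γ • opW p m W y‖ ^ 2 = _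
    rw [norm_smul, mul_pow, Real.norm_eq_abs, sq_abs, hWy]
  have hγ := mul_le_mul_of_nonneg_left hWlow (sq_nonneg p.γ)
  rw [hBT, hnorm, Params.μB]
  rw [hp.γ_sq] at hγ ⊢
  have hμ := mul_nonneg hp.A_pos.le (sq_nonneg ‖yo‖)
  linarith

/-- A minimizer of the coupled problem lifts to a solution of the problem with constraint
`A x + γ W' y = b`. -/
theorem exists_liftedProblem (hp : p.Valid) {f : ∀ i, EuclideanSpace ℝ (Fin (d i)) → ℝ}
    (hf : ∀ i, SmoothStronglyConvex p.Lf p.μf (f i)) {A : ∀ i, Matrix (Fin m) (Fin (d i)) ℝ}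
    {b : Blocks n m} (hA : ConstraintBounds p.LA p.μA A b) (hW : IsGossip G p.LW p.μW W)
    {xs : Primal n d} (hxs : sumBlocks n m (linA A xs) = sumBlocks n m b)
    (hopt : ∀ v, sumBlocks n m (linA A v) = 0 → inner ℝ (gradF f xs) v = 0) :
    ∃ us : WithLp 2 (Primal n d × Blocks n m), us.fst = xs ∧
      LiftedProblem p (oracles f A W) b (linA A) (linAT A) (opW p m W) (objF f) us := by
  have hK := wellConditioned_opW (m := m) hp hW
  obtain ⟨q, hq⟩ := exists_opW_opW_eq hp hW (v := b - linA A xs) (by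
    rw [map_sub, hxs, sub_self])
  refine ⟨WithLp.toLp 2 (xs, p.γ⁻¹ • opW p m W q), rfl, ?_⟩
  refine ⟨hp, rfl, rfl, value_mulW'_eq_opW hp _ rfl, inner_linA A, norm_linA_sq_le hA.upper, hK,
    mapBT_lower hp hW hA, objF_lower hf, objF_upper hf, ?_, ?_, fun v hv => ?_⟩
  · exact Submodule.smul_mem _ _ ⟨q, rfl⟩
  · change linA A xs + p.γ • opW p m W (p.γ⁻¹ • opW p m W q) = b
    rw [map_smul, smul_smul, mul_inv_cancel₀ hp.γ_pos.ne', one_smul, hq]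
    abel
  · refine hopt v.fst ?_
    have hv' : linA A v.fst = -(p.γ • opW p m W v.snd) := eq_neg_of_add_eq_zero_left hv
    refine ext_inner_right ℝ fun c => ?_
    rw [← inner_consensus, hv', inner_neg_left, inner_smul_left, hK.symm,
      (opW_eq_zero_iff hp hW _).2 ⟨c, rfl⟩]
    simp

/-! ### Iteration count and total cost -/

/-- The number of iterations needed for accuracy `ε`, from the linear rate. The constant is
`264 = 24 * 11`, from `log (1 + τ / 12) ≥ τ / 24` and `1 / τ ≤ 11 √κ_f`. -/
theorem exists_iteration_le (hp : p.Valid) {e : ℕ → ℝ} {D : ℝ} (hD : 0 < D)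
    (he : ∀ k, (1 + p.τ / 12) ^ k * e k ≤ D) {ε : ℝ} (hε : 0 < ε) :
    ∃ k : ℕ, e k ≤ ε ∧
      (k : ℝ) ≤ 264 * √p.κf * max 0 (Real.log (Real.exp 1 * D / ε)) := by
  have hτ := Params.τ_pos (p := p)
  have hτ1 := Params.τ_le_one (p := p)
  rcases le_or_gt D ε with hDε | hDε
  · refine ⟨0, ?_, ?_⟩
    · have := he 0
      simp only [pow_zero, one_mul] at this
      linarith
    · simp only [Nat.cast_zero]
      positivity
  have hl : 0 < Real.log (D / ε) := Real.log_pos ((one_lt_div hε).2 hDε)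
  have hlog : Real.log (Real.exp 1 * D / ε) = 1 + Real.log (D / ε) := by
    rw [mul_div_assoc, Real.log_mul (Real.exp_pos 1).ne' (by positivity), Real.log_exp]
  set l := Real.log (D / ε) with hl'
  refine ⟨⌈24 / p.τ * l⌉₊, ?_, ?_⟩
  · set k := ⌈24 / p.τ * l⌉₊
    have hk : 24 / p.τ * l ≤ k := Nat.le_ceil _
    have h1 : p.τ / 24 ≤ Real.log (1 + p.τ / 12) := by
      refine le_trans ?_ (Real.le_log_one_add_of_nonneg (by positivity))
      rw [div_le_div_iff₀ (by norm_num) (by positivity)]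
      nlinarith
    have h2 : l ≤ k * Real.log (1 + p.τ / 12) := by
      have h3 : l ≤ k * (p.τ / 24) := by
        have := mul_le_mul_of_nonneg_right hk (by positivity : 0 ≤ p.τ / 24)
        refine le_trans (le_of_eq ?_) this
        field_simp
      exact h3.trans (mul_le_mul_of_nonneg_left h1 (Nat.cast_nonneg k))
    have h4 : D / ε ≤ (1 + p.τ / 12) ^ k := by
      rw [← Real.log_le_log_iff (by positivity) (by positivity), Real.log_pow]
      exact h2
    have h5 := he k
    rw [div_le_iff₀ hε] at h4
    have hpos : 0 < (1 + p.τ / 12) ^ k := by positivity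
    exact le_of_mul_le_mul_left (h5.trans h4) hpos
  · have h1 := (Nat.ceil_lt_add_one (by positivity : 0 ≤ 24 / p.τ * l)).le
    have h2 := hp.inv_τ_le
    have h3 : 1 ≤ 24 / p.τ := by rw [le_div_iff₀ hτ]; linarith
    have h4 : 24 / p.τ ≤ 264 * √p.κf := by
      have : 24 / p.τ = 24 * (1 / p.τ) := by ring
      linarith
    rw [hlog, max_eq_right (by linarith)]
    have h5 := mul_le_mul_of_nonneg_right h4 (by linarith : 0 ≤ 1 + l)
    linarith

/-- Bounds on the number of iterations give bounds on the three costs. -/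
theorem reachesWithin_of_iterations (hp : p.Valid) {f : ∀ i, EuclideanSpace ℝ (Fin (d i)) → ℝ}
    {A : ∀ i, Matrix (Fin m) (Fin (d i)) ℝ} {b : Blocks n m} {x₀ xs : Primal n d} {c ε ℓ : ℝ}
    (k : ℕ) (hk : (k : ℝ) ≤ c * √p.κf * ℓ)
    (he : ‖((mainAlg p b x₀ k).value (oracles f A W)).u.1 - xs‖ ^ 2 ≤ ε) :
    ReachesWithin p f A b W x₀ xs (36 * c) ε ℓ := by
  refine ⟨k, he, ?_⟩
  rw [cost_mainAlg b hp.one_le_stepsW hp.one_le_stepsB]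
  have h1 : 1 ≤ √p.κA := Real.one_le_sqrt.2 hp.one_le_κA
  have h2 : 1 ≤ √p.κW := Real.one_le_sqrt.2 hp.one_le_κW
  have h3 := hp.stepsW_le
  have h4 := hp.stepsB_le
  have hk0 : (0 : ℝ) ≤ k := Nat.cast_nonneg k
  have hK := hk0.trans hk
  refine ⟨by linarith, ?_, ?_⟩
  · have h5 : 2 + 2 * (p.stepsB : ℝ) ≤ 36 * √p.κA := by linarith
    have h6 := mul_le_mul hk h5 (by positivity) hK
    push_cast
    linarith
  · have h5 : 2 * (p.stepsW : ℝ) + 2 * p.stepsW * p.stepsB ≤ 36 * (√p.κA * √p.κW) := by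
      have h6 : (2 * p.stepsW : ℝ) * (1 + p.stepsB) ≤ (4 * √p.κW) * (9 * √p.κA) :=
        mul_le_mul (by linarith) (by linarith) (by positivity) (by positivity)
      linarith
    have h6 := mul_le_mul hk h5 (by positivity) hK
    push_cast
    linarith

end Problem

end CoupledOpt

theorem theorem1 :
    ∃ C : ℝ, 0 < C ∧
      ∀ (n m : ℕ) (d : Fin n → ℕ) (f : ∀ i, EuclideanSpace ℝ (Fin (d i)) → ℝ)
        (A : ∀ i, Matrix (Fin m) (Fin (d i)) ℝ) (b : CoupledOpt.Blocks n m)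
        (G : SimpleGraph (Fin n)) (W : Matrix (Fin n) (Fin n) ℝ) (p : CoupledOpt.Params),
        p.Valid →
        (∀ i, CoupledOpt.SmoothStronglyConvex p.Lf p.μf (f i)) →
        CoupledOpt.ConstraintBounds p.LA p.μA A b →
        CoupledOpt.IsGossip G p.LW p.μW W →
        ∃ xs : CoupledOpt.Primal n d,
          CoupledOpt.IsSolution f A b xs ∧
          (∀ x, CoupledOpt.IsSolution f A b x → x = xs) ∧
          ∀ x₀ : CoupledOpt.Primal n d,
            (∃ D : ℝ, 0 < D ∧ ∀ ε : ℝ, 0 < ε →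
              CoupledOpt.ReachesWithin p f A b W x₀ xs C ε (max 0 (Real.log (D / ε)))) ∧
            (∃ ε₀ : ℝ, 0 < ε₀ ∧ ε₀ < 1 ∧ ∀ ε : ℝ, 0 < ε → ε ≤ ε₀ →
              CoupledOpt.ReachesWithin p f A b W x₀ xs C ε (Real.log (1 / ε))) := by
  refine ⟨36 * 528, by norm_num, ?_⟩
  intro n m d f A b G W p hp hf hA hW
  obtain ⟨xf, hxf⟩ := hA.feasible
  rw [CoupledOpt.feasible_iff] at hxf
  obtain ⟨xs, hxs, hmin⟩ := CoupledOpt.exists_constrained_min hp.f_pos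
    (CoupledOpt.continuous_objF hf) (CoupledOpt.objF_lower hf)
    (CoupledOpt.sumBlocks n m ∘ₗ CoupledOpt.linA A) xf
  have hopt : ∀ v, CoupledOpt.sumBlocks n m (CoupledOpt.linA A v) = 0 →
      inner ℝ (CoupledOpt.gradF f xs) v = 0 := fun v hv =>
    CoupledOpt.inner_grad_eq_zero (CoupledOpt.objF_upper hf)
      (T := CoupledOpt.sumBlocks n m ∘ₗ CoupledOpt.linA A)
      (fun y hy => hmin y (hy.trans hxs)) hv
  have hxsb : CoupledOpt.sumBlocks n m (CoupledOpt.linA A xs) = CoupledOpt.sumBlocks n m b :=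
    hxs.trans hxf
  obtain ⟨us, hus, hP⟩ := CoupledOpt.exists_liftedProblem hp hf hA hW hxsb hopt
  have hsol : CoupledOpt.IsSolution f A b xs :=
    ⟨(CoupledOpt.feasible_iff A b xs).2 hxsb, fun x' hx' => hmin x'
      (((CoupledOpt.feasible_iff A b x').1 hx').trans hxf.symm)⟩
  refine ⟨xs, hsol, fun x hx => ?_, fun x₀ => ?_⟩
  · have h1 := CoupledOpt.objF_lower hf xs x
    have h2 : CoupledOpt.objF f x ≤ CoupledOpt.objF f xs := hx.2 xs hsol.1
    rw [hopt (x - xs) (by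
      rw [map_sub, map_sub, (CoupledOpt.feasible_iff A b x).1 hx.1, hxsb, sub_self])] at h1
    have h3 : ‖x - xs‖ ^ 2 ≤ 0 := by nlinarith [hp.f_pos]
    have h4 : ‖x - xs‖ = 0 := by simpa using le_antisymm h3 (sq_nonneg _)
    exact sub_eq_zero.1 (norm_eq_zero.1 h4)
  · obtain ⟨D, hD, hrate⟩ := hP.exists_linear_rate x₀
    rw [hus] at hrate
    have hDe : 0 < Real.exp 1 * D := by positivity
    refine ⟨⟨Real.exp 1 * D, hDe, fun ε hε => ?_⟩,
      ⟨min (1 / 2) (1 / (Real.exp 1 * D)), by positivity,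
        (min_le_left _ _).trans_lt (by norm_num), fun ε hε hle => ?_⟩⟩
    · obtain ⟨k, hk, hkℓ⟩ := CoupledOpt.exists_iteration_le hp hD hrate hε
      refine CoupledOpt.reachesWithin_of_iterations hp k (hkℓ.trans ?_) hk
      gcongr
      norm_num
    · obtain ⟨k, hk, hkℓ⟩ := CoupledOpt.exists_iteration_le hp hD hrate hε
      refine CoupledOpt.reachesWithin_of_iterations hp k (hkℓ.trans ?_) hk
      -- For `ε ≤ 1 / D` the constant `D` inside the logarithm costs at most a factor `2`.
      have h1 : ε ≤ 1 / (Real.exp 1 * D) := hle.trans (min_le_right _ _)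
      have h2 : Real.exp 1 * D ≤ 1 / ε := by
        rwa [le_div_iff₀ hε, mul_comm, ← le_div_iff₀ hDe]
      have h3 : 0 ≤ Real.log (1 / ε) := by
        refine Real.log_nonneg ?_
        rw [le_div_iff₀ hε]
        linarith [hle.trans (min_le_left _ _)]
      have h4 : max 0 (Real.log (Real.exp 1 * D / ε)) ≤ 2 * Real.log (1 / ε) := by
        refine max_le (by linarith) ?_
        rw [div_eq_mul_one_div, Real.log_mul hDe.ne' (by positivity)]
        linarith [Real.log_le_log hDe h2]
      have h5 := mul_le_mul_of_nonneg_left h4 (by positivity : 0 ≤ 264 * √p.κf)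
      linarith
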